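/- Let $M_2$ denote the complex $2\times 2$ matrices. A qubit channel is a completely positive trace-preserving linear map $\Phi : M_2\to M_2$; it is unital if $\Phi(I/2)=I/2$. Its Kraus rank is the rank of its Choi matrix $(\Phi\otimes \mathrm{id})(|\mathrm{Bell}\rangle\langle \mathrm{Bell}|)$, where $|\mathrm{Bell}\rangle=\frac{1}{\sqrt2}(|00\rangle+|11\rangle)$. For a unitary $2\times2$ matrix $U$ let $\Phi_U(\rho)=U\rho U^\dagger$, and let $\mathcal U_2$ be the set of these unitary channels. For $t\in[0,1]$ let $\Phi_{\rm PF}(t)(\rho)=(1-t)\rho+t\,\sigma_z\rho\,\sigma_z$, with $\sigma_z=\mathrm{diag}(1,-1)$, be the phase flip channel. Call channels $\Psi,\Phi$ unitarily equivalent if $\Psi=\Phi_U\circ\Phi\circ\Phi_V$ for some unitary $U,V$. A set $\mathcal F$ of qubit channels is universal for the unital qubit channels if every unital qubit channel is of the form $\Phi_n\circ\cdots\circ\Phi_1$ with $n\ge 1$ and $\Phi_1,\dots,\Phi_n\in\mathcal F$. **Theorem.** Let $\varepsilon>0$, let $\mathcal I_2$ be the set of unital qubit channels of Kraus rank $3$,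 let $\mathcal F_{\rm PF}(\varepsilon)=\{\Phi_{\rm PF}(t): 0\le t\le \min(\varepsilon,1)\}$, and let $$\mathcal G^\varepsilon=\mathcal I_2\cup\mathcal F_{\rm PF}(\varepsilon)\cup\{\Phi_{\rm PF}(1/2)\}\cup\mathcal U_2 .$$ Then $\mathcal G^\varepsilon$ is universal for the unital qubit channels, and the set of all finite concatenations of elements of $\mathcal G^\varepsilon$ is exactly the set of unital qubit channels. Moreover $\mathcal G^\varepsilon$ is minimal in the following sense. Every set $\mathcal F$ of qubit channels (unital or not) that is universal for the unital qubit channels contains 1. for each $\Phi\in\mathcal I_2$, a channel unitarily equivalent to $\Phi$; 2. a channel unitarily equivalent to $\Phi_{\rm PF}(1/2)$; 3. a channel unitarily equivalent to $\Phi_{\rm PF}(\varepsilon')$ for some $\varepsilon'$ with $0<\varepsilon'\le\varepsilon$ and $\varepsilon'<1/2$. -/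

import Mathlib

open Matrix
open scoped ComplexOrder

/-- The `2 × 2` complex matrices, on which qubit channels act. -/
abbrev Mat2 : Type := Matrix (Fin 2) (Fin 2) ℂ

/-- Linear maps on the `2 × 2` matrices; the product of the ring `Module.End` is composition. -/
abbrev SuperOp : Type := Module.End ℂ Mat2

/-- `(Φ ⊗ id_k)(A)` for a matrix `A` on `ℂ² ⊗ ℂᵏ`: the map `Φ` is applied to each of the `k × k`
blocks of `A` (the blocks being indexed by the second tensor factor). -/
def ampliate (k : ℕ) (Φ : SuperOp) (A : Matrix (Fin 2 × Fin k) (Fin 2 × Fin k) ℂ) :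
    Matrix (Fin 2 × Fin k) (Fin 2 × Fin k) ℂ :=
  Matrix.of fun x y => Φ (Matrix.of fun i j => A (i, x.2) (j, y.2)) x.1 y.1

/-- Complete positivity: `Φ ⊗ id_k` preserves positive semidefiniteness, for every `k`. -/
def IsCompletelyPositive (Φ : SuperOp) : Prop :=
  ∀ (k : ℕ) (A : Matrix (Fin 2 × Fin k) (Fin 2 × Fin k) ℂ),
    A.PosSemidef → (ampliate k Φ A).PosSemidef

/-- Qubit channels: completely positive trace preserving linear maps. -/
def qubitChannels : Set SuperOp :=
  {Φ | IsCompletelyPositive Φ ∧ ∀ ρ : Mat2, (Φ ρ).trace = ρ.trace}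

/-- Unital qubit channels: they leave the fully mixed state (half the identity) invariant. -/
def unitalQubitChannels : Set SuperOp :=
  {Φ | Φ ∈ qubitChannels ∧ Φ ((1 / 2 : ℂ) • (1 : Mat2)) = (1 / 2 : ℂ) • (1 : Mat2)}

/-- The Bell vector `(|00⟩ + |11⟩) / √2`. -/
noncomputable def bellVector : Fin 2 × Fin 2 → ℂ :=
  fun x => if x.1 = x.2 then 1 / (Real.sqrt 2 : ℂ) else 0

/-- The Choi matrix `(Φ ⊗ id_2)(|Bell⟩⟨Bell|)`. -/
noncomputable def choiMatrix (Φ : SuperOp) : Matrix (Fin 2 × Fin 2) (Fin 2 × Fin 2) ℂ :=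
  ampliate 2 Φ (Matrix.vecMulVec bellVector (star bellVector))

/-- The unital qubit channels of Kraus rank three, the Kraus rank being the rank of the
Choi matrix. -/
def rankThreeUnitalChannels : Set SuperOp :=
  {Φ | Φ ∈ unitalQubitChannels ∧ (choiMatrix Φ).rank = 3}

/-- The unitary channel `ρ ↦ U ρ U†`. -/
noncomputable def unitaryChannel (U : Matrix.unitaryGroup (Fin 2) ℂ) : SuperOp :=
  LinearMap.mulLeftRight ℂ ((U : Mat2), (U : Mat2)ᴴ)

/-- The set of unitary channels. -/
def unitaryChannels : Set SuperOp := Set.range unitaryChannel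

/-- The Pauli matrix `σ_z`. -/
def pauliZ : Mat2 := !![1, 0; 0, -1]

/-- The phase flip `ρ ↦ (1 - t) ρ + t σ_z ρ σ_z`; it is a channel for `0 ≤ t ≤ 1`. -/
noncomputable def phaseFlip (t : ℝ) : SuperOp :=
  ((1 - t : ℝ) : ℂ) • (LinearMap.id : SuperOp) +
    (t : ℂ) • LinearMap.mulLeftRight ℂ (pauliZ, pauliZ)

/-- The phase flip channels of parameter at most `T`. -/
def phaseFlipsUpTo (T : ℝ) : Set SuperOp :=
  {Φ | ∃ t : ℝ, 0 ≤ t ∧ t ≤ 1 ∧ t ≤ T ∧ Φ = phaseFlip t}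

/-- The maps `Φ_n ∘ ⋯ ∘ Φ_1` with `n ≥ 1` and all `Φ_i` in `F`. -/
def generatedBy (F : Set SuperOp) : Set SuperOp :=
  {Φ | ∃ l : List SuperOp, l ≠ [] ∧ (∀ Ψ ∈ l, Ψ ∈ F) ∧ Φ = l.prod}

/-- A set `F` of qubit channels is universal for a set `C` of channels if every member of `C` is
a finite concatenation of members of `F`. -/
def IsUniversalFor (F C : Set SuperOp) : Prop :=
  F ⊆ qubitChannels ∧ C ⊆ generatedBy F

/-- `Ψ` equals `Φ` up to composition with unitary channels on both sides. -/
def UnitarilyEquivalent (Ψ Φ : SuperOp) : Prop :=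
  ∃ U V : Matrix.unitaryGroup (Fin 2) ℂ, Ψ = unitaryChannel U * Φ * unitaryChannel V

/-- The candidate universal set: rank-three unital channels, phase flips of parameter at most `ε`,
the half phase flip, and the unitary channels. -/
def universalSet (ε : ℝ) : Set SuperOp :=
  rankThreeUnitalChannels ∪ phaseFlipsUpTo ε ∪ {phaseFlip (1 / 2)} ∪ unitaryChannels

/-! The structural fact is `exists_pauli_form`: up to unitaries on both sides, a unital channel is a
mixture of the four Pauli conjugations. In the basis of quaternion units, a unital channel is given
by a real symmetric matrix. Its real eigenvectors are unit quaternions, hence unitaries, and a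
change of basis turns four orthogonal ones into the Pauli matrices up to phases. The Kraus rank is
then the number of nonzero weights.

Universality. If all four weights are positive, a phase flip can be split off so that some weight of
the remaining mixture vanishes (`pauliMixture_mem`). With exactly one zero weight the mixture is
itself a generator. With more it is a rotated phase flip times a Pauli unitary. A phase flip of
parameter `(1 - r) / 2` multiplies the off-diagonal entries by `r`, and these multipliers compose by
multiplication. Weak flips thus yield every `r > 0`, the half flip supplies `r = 0`, and `σ_z`
changes the sign.

Minimality. The form `krausForm` detects the matrices orthogonal to all Kraus operators, whichever
Kraus representation is used. For rank three these form the line through an invertible matrix, and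
this forces one of any two factors to be unitary (`unitary_or_unitary_of_krausForm`). Hence any word
for such a channel contains an equivalent letter. For phase flips, `exists_dephasing_of_mul_eq`
shows that all factors are again phase flips up to unitaries, with multipliers whose product is `r`.
If `r = 0` some letter has multiplier zero; if `0 ≤ r < 1` some letter has multiplier in `[r, 1)`.
-/

/-! ### Conjugation maps and unitary channels -/

/-- Conjugation `ρ ↦ K ρ K†` by a matrix. -/
noncomputable def conjBy (K : Mat2) : SuperOp := LinearMap.mulLeftRight ℂ (K, Kᴴ)

theorem conjBy_apply (K ρ : Mat2) : conjBy K ρ = K * ρ * Kᴴ := by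
  simp [conjBy]

theorem conjBy_mul (K L : Mat2) : conjBy K * conjBy L = conjBy (K * L) := by
  refine LinearMap.ext fun ρ => ?_
  simp [conjBy_apply, Module.End.mul_apply, Matrix.mul_assoc]

theorem conjBy_one : conjBy 1 = 1 := by
  refine LinearMap.ext fun ρ => ?_
  simp [conjBy_apply]

theorem conjBy_smul (c : ℂ) (K : Mat2) : conjBy (c • K) = (c * star c) • conjBy K := by
  refine LinearMap.ext fun ρ => ?_
  simp [conjBy_apply, smul_smul, mul_comm]

theorem unitaryChannel_eq (U : Matrix.unitaryGroup (Fin 2) ℂ) :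
    unitaryChannel U = conjBy (U : Mat2) := rfl

theorem unitaryChannel_mul (U V : Matrix.unitaryGroup (Fin 2) ℂ) :
    unitaryChannel U * unitaryChannel V = unitaryChannel (U * V) := by
  simp [unitaryChannel_eq, conjBy_mul]

theorem unitaryChannel_one : unitaryChannel 1 = 1 := by
  simp [unitaryChannel_eq, conjBy_one]

theorem unitaryChannel_mul_inv (U : Matrix.unitaryGroup (Fin 2) ℂ) :
    unitaryChannel U * unitaryChannel U⁻¹ = 1 := by
  rw [unitaryChannel_mul, mul_inv_cancel, unitaryChannel_one]

theorem unitaryChannel_inv_mul (U : Matrix.unitaryGroup (Fin 2) ℂ) :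
    unitaryChannel U⁻¹ * unitaryChannel U = 1 := by
  rw [unitaryChannel_mul, inv_mul_cancel, unitaryChannel_one]

theorem phaseFlip_eq (t : ℝ) :
    phaseFlip t = ((1 - t : ℝ) : ℂ) • (1 : SuperOp) + (t : ℂ) • conjBy pauliZ := by
  have : pauliZᴴ = pauliZ := by
    ext i j; fin_cases i <;> fin_cases j <;> simp [pauliZ]
  rw [phaseFlip, conjBy, this]; rfl

/-! ### Kraus representations -/

/-- The map with Kraus operators `K i`. -/
noncomputable def krausMap {ι : Type*} [Fintype ι] (K : ι → Mat2) : SuperOp := ∑ i, conjBy (K i)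

theorem krausMap_apply {ι : Type*} [Fintype ι] (K : ι → Mat2) (ρ : Mat2) :
    krausMap K ρ = ∑ i, K i * ρ * (K i)ᴴ := by
  simp [krausMap, conjBy_apply, LinearMap.sum_apply]

theorem krausMap_mul {ι κ : Type*} [Fintype ι] [Fintype κ] (K : ι → Mat2) (L : κ → Mat2) :
    krausMap K * krausMap L = krausMap fun p : ι × κ => K p.1 * L p.2 := by
  simp [krausMap, Finset.sum_mul_sum, conjBy_mul, Fintype.sum_prod_type]

/-- The outer factors are `K ⊗ 1` and its adjoint, so positivity of the ampliation is immediate. -/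
theorem ampliate_conjBy (k : ℕ) (K : Mat2) (A : Matrix (Fin 2 × Fin k) (Fin 2 × Fin k) ℂ) :
    ampliate k (conjBy K) A =
      (Matrix.of fun x y => if x.2 = y.2 then K x.1 y.1 else 0) * A *
        (Matrix.of fun x y => if x.2 = y.2 then K x.1 y.1 else 0)ᴴ := by
  ext x y
  simp [ampliate, conjBy_apply, Matrix.mul_apply, Fintype.sum_prod_type, apply_ite]

theorem IsCompletelyPositive.conjBy (K : Mat2) : IsCompletelyPositive (conjBy K) := by
  intro k A hA
  rw [ampliate_conjBy]
  exact hA.mul_mul_conjTranspose_same _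

theorem IsCompletelyPositive.add {Φ Ψ : SuperOp} (hΦ : IsCompletelyPositive Φ)
    (hΨ : IsCompletelyPositive Ψ) : IsCompletelyPositive (Φ + Ψ) := fun k A hA =>
  (hΦ k A hA).add (hΨ k A hA)

theorem IsCompletelyPositive.smul {Φ : SuperOp} (hΦ : IsCompletelyPositive Φ) {c : ℝ}
    (hc : 0 ≤ c) : IsCompletelyPositive ((c : ℂ) • Φ) := fun k A hA =>
  (hΦ k A hA).smul (Complex.zero_le_real.2 hc)

theorem IsCompletelyPositive.mul {Φ Ψ : SuperOp} (hΦ : IsCompletelyPositive Φ)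
    (hΨ : IsCompletelyPositive Ψ) : IsCompletelyPositive (Φ * Ψ) := fun k A hA =>
  hΦ k _ (hΨ k A hA)

theorem mul_mem_qubitChannels {Φ Ψ : SuperOp} (hΦ : Φ ∈ qubitChannels) (hΨ : Ψ ∈ qubitChannels) :
    Φ * Ψ ∈ qubitChannels :=
  ⟨hΦ.1.mul hΨ.1, fun ρ => (hΦ.2 _).trans (hΨ.2 ρ)⟩

theorem mul_mem_unitalQubitChannels {Φ Ψ : SuperOp} (hΦ : Φ ∈ unitalQubitChannels)
    (hΨ : Ψ ∈ unitalQubitChannels) : Φ * Ψ ∈ unitalQubitChannels :=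
  ⟨mul_mem_qubitChannels hΦ.1 hΨ.1, by rw [Module.End.mul_apply, hΨ.2, hΦ.2]⟩

theorem unitaryChannel_mem (U : Matrix.unitaryGroup (Fin 2) ℂ) :
    unitaryChannel U ∈ unitalQubitChannels := by
  have h1 : (U : Mat2)ᴴ * (U : Mat2) = 1 := Unitary.coe_star_mul_self U
  have h2 : (U : Mat2) * (U : Mat2)ᴴ = 1 := Unitary.coe_mul_star_self U
  refine ⟨⟨IsCompletelyPositive.conjBy _, fun ρ => ?_⟩, ?_⟩
  · rw [unitaryChannel_eq, conjBy_apply, Matrix.trace_mul_comm, ← Matrix.mul_assoc, h1,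
      Matrix.one_mul]
  · rw [unitaryChannel_eq, conjBy_apply]
    simp [h2]

/-- Convex combinations of unitary channels are unital channels. -/
theorem sum_smul_unitaryChannel_mem {ι : Type*} [Fintype ι] (p : ι → ℝ) (hp : ∀ i, 0 ≤ p i)
    (hs : ∑ i, p i = 1) (U : ι → Matrix.unitaryGroup (Fin 2) ℂ) :
    ∑ i, (p i : ℂ) • unitaryChannel (U i) ∈ unitalQubitChannels := by
  have hs' : ∑ i, (p i : ℂ) = 1 := by exact_mod_cast hs
  refine ⟨⟨?_, fun ρ => ?_⟩, ?_⟩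
  · have : ∀ s : Finset ι, IsCompletelyPositive (∑ i ∈ s, (p i : ℂ) • unitaryChannel (U i)) := by
      classical
      intro s
      induction s using Finset.induction_on with
      | empty =>
        intro k A _
        have : ampliate k 0 A = 0 := by ext; simp [ampliate]
        rw [Finset.sum_empty, this]
        exact Matrix.PosSemidef.zero
      | insert a s ha ih =>
        rw [Finset.sum_insert ha]
        exact ((unitaryChannel_mem (U a)).1.1.smul (hp a)).add ih
    exact this _
  · simp [LinearMap.sum_apply, Matrix.trace_sum, (unitaryChannel_mem _).1.2, ← Finset.sum_mul, hs']
  · simp only [LinearMap.sum_apply, LinearMap.smul_apply, (unitaryChannel_mem _).2]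
    rw [← Finset.sum_smul, hs', one_smul]

/-- The factor 2 undoes the normalisation of the Bell vector: each block of the Bell projector is
half a matrix unit. -/
theorem apply_single_eq_choiMatrix (Φ : SuperOp) (x y : Fin 2 × Fin 2) :
    Φ (Matrix.single x.2 y.2 1) x.1 y.1 = 2 * choiMatrix Φ x y := by
  have h : (Matrix.of fun i j => Matrix.vecMulVec bellVector (star bellVector) (i, x.2) (j, y.2) :
      Mat2) = (1 / 2 : ℂ) • Matrix.single x.2 y.2 1 := by
    have h2 : ((Real.sqrt 2 : ℂ))⁻¹ * (Real.sqrt 2 : ℂ)⁻¹ = 1 / 2 := by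
      rw [← mul_inv, ← Complex.ofReal_mul, Real.mul_self_sqrt (by norm_num)]; norm_num
    ext i j
    simp only [Matrix.of_apply, Matrix.vecMulVec_apply, bellVector, Pi.star_apply,
      Matrix.smul_apply, Matrix.single_apply]
    by_cases hi : i = x.2 <;> by_cases hj : j = y.2 <;>
      simp [hi, hj, h2, eq_comm]
  rw [choiMatrix, ampliate, Matrix.of_apply, h, map_smul]
  simp

theorem IsCompletelyPositive.choiMatrix_posSemidef {Φ : SuperOp} (h : IsCompletelyPositive Φ) :
    (choiMatrix Φ).PosSemidef :=
  h 2 _ (Matrix.posSemidef_vecMulVec_self_star _)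

theorem superOp_ext {Φ Ψ : SuperOp}
    (h : ∀ i j, Φ (Matrix.single i j 1) = Ψ (Matrix.single i j 1)) : Φ = Ψ := by
  refine Matrix.ext_linearMap ℂ fun i j => ?_
  refine LinearMap.ext_ring ?_
  simpa using h i j

theorem conjBy_single_apply (K : Mat2) (i j k l : Fin 2) :
    conjBy K (Matrix.single i j 1) k l = K k i * star (K l j) := by
  rw [conjBy_apply]
  fin_cases i <;> fin_cases j <;> simp [Matrix.mul_apply, Matrix.single_apply]

/-- A completely positive map has a Kraus representation. -/
theorem IsCompletelyPositive.exists_kraus {Φ : SuperOp} (h : IsCompletelyPositive Φ) :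
    ∃ K : Fin 2 × Fin 2 → Mat2, Φ = krausMap K := by
  obtain ⟨B, hB⟩ : ∃ B, choiMatrix Φ = Bᴴ * B := by
    open scoped MatrixOrder in
    exact CStarAlgebra.nonneg_iff_eq_star_mul_self.1 h.choiMatrix_posSemidef.nonneg
  have h2 : (Real.sqrt 2 : ℂ) * (Real.sqrt 2 : ℂ) = 2 := by
    rw [← Complex.ofReal_mul, Real.mul_self_sqrt (by norm_num)]; norm_num
  -- The Kraus operators are the conjugated rows of the factor `B`, reshaped to matrices; `√2`
  -- compensates the Bell normalisation.
  refine ⟨fun k => Matrix.of fun i j => (Real.sqrt 2 : ℂ) * star (B k (i, j)), superOp_ext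
    fun i j => ?_⟩
  ext k l
  rw [apply_single_eq_choiMatrix Φ (k, i) (l, j), hB, krausMap, LinearMap.sum_apply,
    Matrix.sum_apply, Matrix.mul_apply, Finset.mul_sum]
  refine Finset.sum_congr rfl fun m _ => ?_
  rw [conjBy_single_apply, ← h2]
  simp
  ring

theorem krausMap_sum_eq_one {ι : Type*} [Fintype ι] {K : ι → Mat2}
    (h : ∀ ρ, (krausMap K ρ).trace = ρ.trace) : ∑ i, (K i)ᴴ * K i = 1 := by
  refine Matrix.ext_iff_trace_mul_right.2 fun ρ => ?_
  rw [Matrix.one_mul, ← h ρ, krausMap_apply, Finset.sum_mul, Matrix.trace_sum, Matrix.trace_sum]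
  refine Finset.sum_congr rfl fun i _ => ?_
  rw [Matrix.mul_assoc, Matrix.trace_mul_comm]

/-! ### A quadratic form that sees the Kraus space -/

/-- The sum of `|tr (M K)|²` over the Kraus operators `K` of `Φ`, see `krausForm_krausMap`. -/
noncomputable def krausForm (Φ : SuperOp) (M : Mat2) : ℂ :=
  ∑ j, ∑ l, (M * Φ (Matrix.single j l 1) * Mᴴ) j l

/-- Each summand is a product of a diagonal entry of `M * K` with the conjugate of another, so the
double sum factors as a trace times its conjugate. -/
theorem krausForm_conjBy (K M : Mat2) :
    krausForm (conjBy K) M = (Complex.normSq (M * K).trace : ℂ) := by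
  have h : ∀ j l, (M * conjBy K (Matrix.single j l 1) * Mᴴ) j l =
      (M * K) j j * star ((M * K) l l) := fun j l => by
    rw [← conjBy_single_apply (M * K) j l j l, ← conjBy_mul, Module.End.mul_apply,
      conjBy_apply M]
  simp_rw [krausForm, h, ← Finset.mul_sum, ← Finset.sum_mul, ← star_sum]
  rw [← Complex.mul_conj]; rfl

theorem krausForm_sum {ι : Type*} [Fintype ι] (Φ : ι → SuperOp) (M : Mat2) :
    krausForm (∑ i, Φ i) M = ∑ i, krausForm (Φ i) M := by
  simp only [krausForm, LinearMap.sum_apply, Finset.mul_sum, Finset.sum_mul, Matrix.sum_apply]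
  simp only [Finset.sum_comm (γ := ι)]

theorem krausForm_smul (c : ℂ) (Φ : SuperOp) (M : Mat2) :
    krausForm (c • Φ) M = c * krausForm Φ M := by
  simp only [krausForm, LinearMap.smul_apply, Matrix.mul_smul, Matrix.smul_mul,
    Matrix.smul_apply, smul_eq_mul, Finset.mul_sum]

theorem krausForm_krausMap {ι : Type*} [Fintype ι] (K : ι → Mat2) (M : Mat2) :
    krausForm (krausMap K) M = ((∑ i, Complex.normSq (M * K i).trace : ℝ) : ℂ) := by
  simp [krausMap, krausForm_sum, krausForm_conjBy]

/-- The left side depends only on the channel. Orthogonality relations therefore transfer between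
different Kraus representations, in particular to the products of the Kraus operators of two
factors. -/
theorem krausForm_krausMap_eq_zero {ι : Type*} [Fintype ι] {K : ι → Mat2} {M : Mat2} :
    krausForm (krausMap K) M = 0 ↔ ∀ i, (M * K i).trace = 0 := by
  rw [krausForm_krausMap, Complex.ofReal_eq_zero,
    Finset.sum_eq_zero_iff_of_nonneg fun i _ => Complex.normSq_nonneg _]
  simp

/-! ### Dephasing maps -/

/-- The map multiplying the off-diagonal entries by `c` and its conjugate. -/
def dephasing (c : ℂ) : SuperOp where
  toFun ρ := !![ρ 0 0, c * ρ 0 1; star c * ρ 1 0, ρ 1 1]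
  map_add' ρ σ := by
    ext i j; fin_cases i <;> fin_cases j <;> simp [mul_add]
  map_smul' a ρ := by
    ext i j; fin_cases i <;> fin_cases j <;> simp [mul_left_comm]

theorem dephasing_apply (c : ℂ) (ρ : Mat2) :
    dephasing c ρ = !![ρ 0 0, c * ρ 0 1; star c * ρ 1 0, ρ 1 1] := rfl

theorem dephasing_mul (c d : ℂ) : dephasing c * dephasing d = dephasing (c * d) := by
  refine LinearMap.ext fun ρ => ?_
  ext i j
  fin_cases i <;> fin_cases j <;> simp [dephasing_apply, Module.End.mul_apply, mul_assoc]

theorem dephasing_inj {c d : ℂ} (h : dephasing c = dephasing d) : c = d := by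
  simpa [dephasing_apply] using congrArg (fun Φ : SuperOp => Φ (Matrix.single 0 1 1) 0 1) h

theorem phaseFlip_eq_dephasing (r : ℝ) : phaseFlip ((1 - r) / 2) = dephasing r := by
  refine LinearMap.ext fun ρ => ?_
  ext i j
  fin_cases i <;> fin_cases j <;>
    simp [dephasing_apply, phaseFlip, pauliZ, Matrix.mul_apply, Matrix.vecMul, dotProduct,
      Fin.sum_univ_two] <;> ring

/-- The diagonal unitary `diag(w, 1)`. -/
def phaseUnitary (w : ℂ) (hw : ‖w‖ = 1) : Matrix.unitaryGroup (Fin 2) ℂ :=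
  ⟨!![w, 0; 0, 1], by
    have h : w * star w = 1 := by
      rw [← starRingEnd_apply, Complex.mul_conj, Complex.normSq_eq_norm_sq, hw]; simp
    rw [Matrix.mem_unitaryGroup_iff]
    ext i j
    fin_cases i <;> fin_cases j <;>
      simpa [Matrix.mul_apply, Fin.sum_univ_two, Matrix.star_apply] using h⟩

theorem dephasing_phase (w : ℂ) (hw : ‖w‖ = 1) :
    dephasing w = unitaryChannel (phaseUnitary w hw) := by
  have h : w * star w = 1 := by
    rw [← starRingEnd_apply, Complex.mul_conj, Complex.normSq_eq_norm_sq, hw]; simp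
  refine LinearMap.ext fun ρ => ?_
  rw [unitaryChannel_eq, conjBy_apply]
  ext i j
  fin_cases i <;> fin_cases j <;>
    simp [dephasing_apply, phaseUnitary, Matrix.mul_apply, Matrix.vecMul, dotProduct,
      Fin.sum_univ_two, mul_comm]
  rw [starRingEnd_apply, mul_right_comm, h, one_mul]

/-- Polar decomposition of `c`: the modulus gives a phase flip, the phase a diagonal unitary. -/
theorem dephasing_eq_phaseFlip_mul (c : ℂ) : ∃ W : Matrix.unitaryGroup (Fin 2) ℂ,
    dephasing c = phaseFlip ((1 - ‖c‖) / 2) * unitaryChannel W := by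
  obtain ⟨w, hw, hc⟩ : ∃ w : ℂ, ‖w‖ = 1 ∧ c = ‖c‖ * w := by
    by_cases h : c = 0
    · exact ⟨1, by simp, by simp [h]⟩
    · have h' : (‖c‖ : ℂ) ≠ 0 := by simpa using h
      exact ⟨c / ‖c‖, by simp [h], by field_simp⟩
  refine ⟨phaseUnitary w hw, ?_⟩
  rw [phaseFlip_eq_dephasing, ← dephasing_phase, dephasing_mul, ← hc]

theorem isDiag_iff_fin_two {M : Mat2} : M.IsDiag ↔ M 0 1 = 0 ∧ M 1 0 = 0 := by
  refine ⟨fun h => ⟨h (by decide), h (by decide)⟩, fun h i j hij => ?_⟩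
  fin_cases i <;> fin_cases j <;> simp_all

/-- A trace preserving map with diagonal Kraus operators is a dephasing map. -/
theorem krausMap_eq_dephasing {ι : Type*} [Fintype ι] {K : ι → Mat2} (hK : ∀ i, (K i).IsDiag)
    (h : ∀ ρ, (krausMap K ρ).trace = ρ.trace) : ∃ c : ℂ, ‖c‖ ≤ 1 ∧ krausMap K = dephasing c := by
  have h1 := krausMap_sum_eq_one h
  have hK' := fun i => isDiag_iff_fin_two.1 (hK i)
  have h00 : ∑ i, K i 0 0 * star (K i 0 0) = 1 := by
    simpa [Matrix.sum_apply, Matrix.mul_apply, Fin.sum_univ_two, hK', mul_comm] using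
      congrFun (congrFun h1 0) 0
  have h11 : ∑ i, K i 1 1 * star (K i 1 1) = 1 := by
    simpa [Matrix.sum_apply, Matrix.mul_apply, Fin.sum_univ_two, hK', mul_comm] using
      congrFun (congrFun h1 1) 1
  have n (f : ι → ℂ) (hf : ∑ i, f i * star (f i) = 1) : ∑ i, ‖f i‖ ^ 2 = 1 := by
    have : ∀ i, f i * star (f i) = ((‖f i‖ ^ 2 : ℝ) : ℂ) := fun i => by
      rw [← starRingEnd_apply, Complex.mul_conj, Complex.normSq_eq_norm_sq]
    simp_rw [this] at hf
    exact_mod_cast hf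
  -- The multiplier is the inner product of the two vectors of diagonal entries, which are unit
  -- vectors by trace preservation.
  refine ⟨∑ i, K i 0 0 * star (K i 1 1), ?_, ?_⟩
  · calc _ ≤ ∑ i, ‖K i 0 0 * star (K i 1 1)‖ := norm_sum_le _ _
      _ ≤ ∑ i, (‖K i 0 0‖ ^ 2 + ‖K i 1 1‖ ^ 2) / 2 := Finset.sum_le_sum fun i _ => by
          rw [norm_mul, norm_star]
          nlinarith [sq_nonneg (‖K i 0 0‖ - ‖K i 1 1‖)]
      _ = 1 := by
          rw [← Finset.sum_div, Finset.sum_add_distrib, n (fun i => K i 0 0) h00,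
            n (fun i => K i 1 1) h11]
          norm_num
  · refine LinearMap.ext fun ρ => ?_
    rw [krausMap_apply, dephasing_apply]
    ext i j
    have key : (∑ i, K i * ρ * (K i)ᴴ) i j = (∑ k, K k i i * star (K k j j)) * ρ i j := by
      rw [Matrix.sum_apply, Finset.sum_mul]
      refine Finset.sum_congr rfl fun k _ => ?_
      fin_cases i <;> fin_cases j <;>
        simp [Matrix.mul_apply, Fin.sum_univ_two, hK', mul_right_comm]
    rw [key]
    fin_cases i <;> fin_cases j
    · simp only [Fin.zero_eta, h00]; simp
    · simp
    · simp [mul_comm]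
    · simp only [Fin.mk_one, h11]; simp

/-- In the plane, two vectors orthogonal to a common nonzero vector are proportional. -/
theorem exists_smul_of_dotProduct_eq_zero {u r d : Fin 2 → ℂ} (hd : d ≠ 0) (hr : r ≠ 0)
    (h1 : r ⬝ᵥ d = 0) (h2 : u ⬝ᵥ d = 0) : ∃ a : ℂ, u = a • r := by
  simp only [dotProduct, Fin.sum_univ_two] at h1 h2
  have hdet : u 0 * r 1 = u 1 * r 0 := by
    by_cases h0 : d 0 = 0
    · have h : d 1 ≠ 0 := fun h => hd (by ext i; fin_cases i <;> simp [h0, h])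
      simp [h0, h] at h1 h2
      simp [h1, h2]
    · refine mul_left_cancel₀ h0 ?_
      linear_combination r 1 * h2 - u 1 * h1
  by_cases h0 : r 0 = 0
  · have h : r 1 ≠ 0 := fun h => hr (by ext i; fin_cases i <;> simp [h0, h])
    refine ⟨u 1 / r 1, ?_⟩
    have : u 0 = 0 := by simpa [h0, h] using hdet
    ext i; fin_cases i <;> simp [h0, h, this]
  · refine ⟨u 0 / r 0, ?_⟩
    ext i; fin_cases i <;> simp [h0]
    field_simp
    linear_combination -hdet

/-- If a product of two channels is a dephasing map, then both factors are dephasing maps up to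
a unitary between them. -/
theorem exists_dephasing_of_mul_eq {A B : SuperOp} (hA : A ∈ qubitChannels)
    (hB : B ∈ qubitChannels) {c : ℂ} (h : A * B = dephasing c) :
    ∃ (P : Matrix.unitaryGroup (Fin 2) ℂ) (a b : ℂ), ‖a‖ ≤ 1 ∧ ‖b‖ ≤ 1 ∧ c = a * b ∧
      A = dephasing a * unitaryChannel P ∧ B = unitaryChannel P⁻¹ * dephasing b := by
  obtain ⟨K, rfl⟩ := hA.1.exists_kraus
  obtain ⟨L, rfl⟩ := hB.1.exists_kraus
  -- A dephasing map has zero Kraus form at both off-diagonal matrix units, so every product of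
  -- Kraus operators of the factors is diagonal.
  have hq : ∀ i j, (K i * L j).IsDiag := by
    intro i j
    have h' := h
    rw [krausMap_mul] at h'
    have q01 : krausForm (dephasing c) (Matrix.single 0 1 1) = 0 := by
      simp [krausForm, dephasing_apply, Matrix.mul_apply, Fin.sum_univ_two, Matrix.single_apply]
    have q10 : krausForm (dephasing c) (Matrix.single 1 0 1) = 0 := by
      simp [krausForm, dephasing_apply, Matrix.mul_apply, Fin.sum_univ_two, Matrix.single_apply]
    rw [← h', krausForm_krausMap_eq_zero] at q01 q10
    rw [isDiag_iff_fin_two]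
    have a := q01 (i, j)
    have b := q10 (i, j)
    rw [Matrix.trace_single_mul] at a b
    simp at a b
    exact ⟨b, a⟩
  have hdiag : ∀ k : Fin 2, ∃ i j, (K i * L j) k k ≠ 0 := by
    intro k
    by_contra! h0
    have := congrFun (congrFun (congrArg (fun Φ : SuperOp => Φ (Matrix.single k k 1)) h) k) k
    rw [krausMap_mul, krausMap, LinearMap.sum_apply, Matrix.sum_apply] at this
    simp only [conjBy_single_apply, h0] at this
    fin_cases k <;> simp [dephasing_apply] at this
  have entry : ∀ i j k l, (K i * L j) k l = K i k ⬝ᵥ (fun m => L j m l) := fun i j k l => rfl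
  obtain ⟨i0, j0, h0⟩ := hdiag 0
  obtain ⟨i1, j1, h1⟩ := hdiag 1
  rw [entry] at h0 h1
  have off01 : ∀ i j, K i 0 ⬝ᵥ (fun m => L j m 1) = 0 := fun i j =>
    (isDiag_iff_fin_two.1 (hq i j)).1
  have off10 : ∀ i j, K i 1 ⬝ᵥ (fun m => L j m 0) = 0 := fun i j =>
    (isDiag_iff_fin_two.1 (hq i j)).2
  -- All top rows of the `K i` are orthogonal to one nonzero second column of an `L j`, hence
  -- proportional to each other. The bottom rows behave likewise, so the `K i` share a right factor
  -- `P0` up to diagonal matrices.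
  choose α hα using fun i => exists_smul_of_dotProduct_eq_zero
    (d := fun m => L j1 m 1) (by rintro h; simp [h] at h1) (r := K i0 0)
    (by rintro h; simp [h] at h0) (off01 i0 j1) (off01 i j1)
  choose β hβ using fun i => exists_smul_of_dotProduct_eq_zero
    (d := fun m => L j0 m 0) (by rintro h; simp [h] at h0) (r := K i1 1)
    (by rintro h; simp [h] at h1) (off10 i1 j0) (off10 i j0)
  set P0 : Mat2 := Matrix.of ![K i0 0, K i1 1] with hP0
  have hKP : ∀ i, K i = Matrix.diagonal ![α i, β i] * P0 := by
    intro i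
    ext k l
    rw [Matrix.diagonal_mul]
    fin_cases k
    · simpa [P0] using congrFun (hα i) l
    · simpa [P0] using congrFun (hβ i) l
  have hPL : ∀ j, (P0 * L j).IsDiag := by
    intro j
    rw [isDiag_iff_fin_two]
    exact ⟨off01 i0 j, off10 i1 j⟩
  set a : ℝ := ∑ i, ‖α i‖ ^ 2 with ha
  set b : ℝ := ∑ i, ‖β i‖ ^ 2 with hb
  -- Trace preservation of the left factor says that `P0` becomes unitary once its rows are rescaled
  -- by `√a` and `√b`.
  have hsum : P0ᴴ * Matrix.diagonal ![(a : ℂ), (b : ℂ)] * P0 = 1 := by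
    rw [← krausMap_sum_eq_one hA.2]
    have : Matrix.diagonal ![(a : ℂ), (b : ℂ)] =
        ∑ i, (Matrix.diagonal ![α i, β i])ᴴ * Matrix.diagonal ![α i, β i] := by
      ext k l
      fin_cases k <;> fin_cases l <;>
        simp [Matrix.sum_apply, ha, hb, Complex.conj_mul']
    rw [this, Finset.mul_sum, Finset.sum_mul]
    refine Finset.sum_congr rfl fun i _ => ?_
    rw [hKP i, Matrix.conjTranspose_mul]
    simp only [Matrix.mul_assoc]
  have hab : a ≠ 0 ∧ b ≠ 0 := by
    have := congrArg Matrix.det hsum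
    rw [Matrix.det_mul, Matrix.det_mul, Matrix.det_diagonal, Matrix.det_one] at this
    constructor <;> intro h0 <;> simp [h0] at this
  have ha0 : 0 ≤ a := Finset.sum_nonneg fun i _ => by positivity
  have hb0 : 0 ≤ b := Finset.sum_nonneg fun i _ => by positivity
  have hsa : (Real.sqrt a : ℂ) * (Real.sqrt a : ℂ) = a := by
    rw [← Complex.ofReal_mul, Real.mul_self_sqrt ha0]
  have hsb : (Real.sqrt b : ℂ) * (Real.sqrt b : ℂ) = b := by
    rw [← Complex.ofReal_mul, Real.mul_self_sqrt hb0]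
  have hsa0 : (Real.sqrt a : ℂ) ≠ 0 := by
    intro h; rw [h] at hsa; exact hab.1 (by exact_mod_cast (by simpa using hsa.symm))
  have hsb0 : (Real.sqrt b : ℂ) ≠ 0 := by
    intro h; rw [h] at hsb; exact hab.2 (by exact_mod_cast (by simpa using hsb.symm))
  set D : Mat2 := Matrix.diagonal ![(Real.sqrt a : ℂ), (Real.sqrt b : ℂ)] with hD
  have hDD : Dᴴ * D = Matrix.diagonal ![(a : ℂ), (b : ℂ)] := by
    ext k l
    fin_cases k <;> fin_cases l <;> simp [D, hsa, hsb]
  let P : Matrix.unitaryGroup (Fin 2) ℂ := ⟨D * P0, by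
    rw [Matrix.mem_unitaryGroup_iff', Matrix.star_eq_conjTranspose, Matrix.conjTranspose_mul,
      ← hsum, ← hDD]
    simp only [Matrix.mul_assoc]⟩
  have hPc : (P : Mat2) = D * P0 := rfl
  have hPinv : ((P⁻¹ : Matrix.unitaryGroup (Fin 2) ℂ) : Mat2) = (P : Mat2)ᴴ := rfl
  have hP1 : (P : Mat2) * (P : Mat2)ᴴ = 1 := Unitary.coe_mul_star_self P
  have hA' : ∃ x : ℂ, ‖x‖ ≤ 1 ∧ krausMap K * unitaryChannel P⁻¹ = dephasing x := by
    have hk : krausMap K * unitaryChannel P⁻¹ = krausMap fun i => K i * (P : Mat2)ᴴ := by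
      rw [krausMap, Finset.sum_mul, unitaryChannel_eq, hPinv]
      simp_rw [conjBy_mul]; rfl
    rw [hk]
    refine krausMap_eq_dephasing (fun i => ?_) ?_
    · have : K i = Matrix.diagonal ![α i / Real.sqrt a, β i / Real.sqrt b] * (P : Mat2) := by
        rw [hKP, hPc, ← Matrix.mul_assoc, hD, Matrix.diagonal_mul_diagonal]
        congr 2
        ext k; fin_cases k <;> simp [hsa0, hsb0]
      rw [this, Matrix.mul_assoc, hP1, Matrix.mul_one]
      exact Matrix.isDiag_diagonal _
    · rw [← hk]
      exact (mul_mem_qubitChannels hA (unitaryChannel_mem _).1).2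
  have hB' : ∃ x : ℂ, ‖x‖ ≤ 1 ∧ unitaryChannel P * krausMap L = dephasing x := by
    have hk : unitaryChannel P * krausMap L = krausMap fun i => (P : Mat2) * L i := by
      rw [krausMap, Finset.mul_sum, unitaryChannel_eq]
      simp_rw [conjBy_mul]; rfl
    rw [hk]
    refine krausMap_eq_dephasing (fun i => ?_) ?_
    · rw [hPc, Matrix.mul_assoc, isDiag_iff_fin_two, hD, Matrix.diagonal_mul, Matrix.diagonal_mul]
      have := isDiag_iff_fin_two.1 (hPL i)
      simp [this]
    · rw [← hk]
      exact (mul_mem_qubitChannels (unitaryChannel_mem _).1 hB).2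
  obtain ⟨x, hx, hxA⟩ := hA'
  obtain ⟨y, hy, hyB⟩ := hB'
  refine ⟨P, x, y, hx, hy, ?_, ?_, ?_⟩
  · apply dephasing_inj
    rw [← dephasing_mul, ← hxA, ← hyB, ← h, mul_assoc, ← mul_assoc (unitaryChannel _),
      unitaryChannel_inv_mul, one_mul]
  · rw [← hxA, mul_assoc, unitaryChannel_inv_mul, mul_one]
  · rw [← hyB, ← mul_assoc, unitaryChannel_inv_mul, one_mul]

/-! ### Factors of phase flips -/

theorem UnitarilyEquivalent.refl (Φ : SuperOp) : UnitarilyEquivalent Φ Φ :=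
  ⟨1, 1, by simp [unitaryChannel_one]⟩

/-- The outer unitaries are absorbed into the factors to apply `exists_dephasing_of_mul_eq`. The
phases of the resulting multipliers go into the unitaries; only their moduli remain, and `0 ≤ r`
makes these multiply to `r`. -/
theorem unitarilyEquivalent_of_mul_eq {A B : SuperOp} (hA : A ∈ qubitChannels)
    (hB : B ∈ qubitChannels) {r : ℝ} (h : UnitarilyEquivalent (A * B) (phaseFlip ((1 - r) / 2)))
    (hr : 0 ≤ r) :
    ∃ a b : ℝ, 0 ≤ a ∧ a ≤ 1 ∧ 0 ≤ b ∧ b ≤ 1 ∧ r = a * b ∧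
      UnitarilyEquivalent A (phaseFlip ((1 - a) / 2)) ∧
      UnitarilyEquivalent B (phaseFlip ((1 - b) / 2)) := by
  obtain ⟨U, V, hUV⟩ := h
  have h' : (unitaryChannel U⁻¹ * A) * (B * unitaryChannel V⁻¹) = dephasing r := by
    rw [mul_assoc, ← mul_assoc A, hUV, phaseFlip_eq_dephasing]
    simp only [mul_assoc, unitaryChannel_mul_inv, mul_one]
    rw [← mul_assoc, unitaryChannel_inv_mul, one_mul]
  obtain ⟨P, a, b, ha, hb, hab, hAa, hBb⟩ := exists_dephasing_of_mul_eq
    (mul_mem_qubitChannels (unitaryChannel_mem _).1 hA)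
    (mul_mem_qubitChannels hB (unitaryChannel_mem _).1) h'
  have hA' : A = unitaryChannel U * (dephasing a * unitaryChannel P) := by
    rw [← hAa, ← mul_assoc, unitaryChannel_mul_inv, one_mul]
  have hB' : B = unitaryChannel P⁻¹ * dephasing b * unitaryChannel V := by
    rw [← hBb, mul_assoc, unitaryChannel_inv_mul, mul_one]
  obtain ⟨W, hW⟩ := dephasing_eq_phaseFlip_mul a
  obtain ⟨X, hX⟩ := dephasing_eq_phaseFlip_mul b
  refine ⟨‖a‖, ‖b‖, norm_nonneg _, ha, norm_nonneg _, hb, ?_, ⟨U, W * P, ?_⟩, ⟨P⁻¹, X * V, ?_⟩⟩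
  · rw [← norm_mul, ← hab, Complex.norm_real, Real.norm_of_nonneg hr]
  · rw [hA', hW, ← unitaryChannel_mul]; simp only [mul_assoc]
  · rw [hB', hX, ← unitaryChannel_mul]; simp only [mul_assoc]

theorem list_prod_mem_qubitChannels {l : List SuperOp} (hl : ∀ Ψ ∈ l, Ψ ∈ qubitChannels) :
    l.prod ∈ qubitChannels := by
  induction l with
  | nil => rw [List.prod_nil, ← unitaryChannel_one]; exact (unitaryChannel_mem _).1
  | cons A l ih =>
    rw [List.prod_cons]
    exact mul_mem_qubitChannels (hl A (by simp)) (ih fun Ψ hΨ => hl Ψ (by simp [hΨ]))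

theorem exists_mem_list_of_prod_equiv_half {l : List SuperOp} (hl : ∀ Ψ ∈ l, Ψ ∈ qubitChannels)
    (h : UnitarilyEquivalent l.prod (phaseFlip ((1 - (0 : ℝ)) / 2))) (hne : l ≠ []) :
    ∃ Ψ ∈ l, UnitarilyEquivalent Ψ (phaseFlip ((1 - (0 : ℝ)) / 2)) := by
  induction l with
  | nil => exact absurd rfl hne
  | cons A l ih =>
    by_cases hl0 : l = []
    · subst hl0; exact ⟨A, by simp, by simpa using h⟩
    rw [List.prod_cons] at h
    obtain ⟨a, b, -, -, -, -, hab, hA, hB⟩ := unitarilyEquivalent_of_mul_eq (hl A (by simp))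
      (list_prod_mem_qubitChannels fun Ψ hΨ => hl Ψ (by simp [hΨ])) h le_rfl
    rcases mul_eq_zero.1 hab.symm with rfl | rfl
    · exact ⟨A, by simp, hA⟩
    · obtain ⟨Ψ, hΨ, hΨ'⟩ := ih (fun Ψ hΨ => hl Ψ (by simp [hΨ])) hB hl0
      exact ⟨Ψ, by simp [hΨ], hΨ'⟩

/-- The multipliers of the letters lie in `[0, 1]` and multiply to `r`, so each is at least `r`, and
they cannot all be 1. A head with multiplier 1 is skipped, leaving `r` unchanged for the tail. -/
theorem exists_mem_list_of_prod_equiv_phaseFlip {l : List SuperOp}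
    (hl : ∀ Ψ ∈ l, Ψ ∈ qubitChannels) {r : ℝ} (hr : 0 ≤ r) (hr1 : r < 1)
    (h : UnitarilyEquivalent l.prod (phaseFlip ((1 - r) / 2))) (hne : l ≠ []) :
    ∃ Ψ ∈ l, ∃ s : ℝ, r ≤ s ∧ s < 1 ∧ UnitarilyEquivalent Ψ (phaseFlip ((1 - s) / 2)) := by
  induction l generalizing r with
  | nil => exact absurd rfl hne
  | cons A l ih =>
    by_cases hl0 : l = []
    · subst hl0; exact ⟨A, by simp, r, le_rfl, hr1, by simpa using h⟩
    rw [List.prod_cons] at h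
    obtain ⟨a, b, ha, ha1, hb, hb1, hab, hA, hB⟩ := unitarilyEquivalent_of_mul_eq (hl A (by simp))
      (list_prod_mem_qubitChannels fun Ψ hΨ => hl Ψ (by simp [hΨ])) h hr
    rcases ha1.lt_or_eq with ha1 | rfl
    · exact ⟨A, by simp, a, by nlinarith, ha1, hA⟩
    · obtain ⟨Ψ, hΨ, s, hs, hs1, hΨ'⟩ := ih (fun Ψ hΨ => hl Ψ (by simp [hΨ])) hb
        (by linarith) hB hl0
      exact ⟨Ψ, by simp [hΨ], s, by linarith, hs1, hΨ'⟩

theorem phaseFlip_mem (t : ℝ) (h0 : 0 ≤ t) (h1 : t ≤ 1) : phaseFlip t ∈ unitalQubitChannels := by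
  have hZ : pauliZ ∈ Matrix.unitaryGroup (Fin 2) ℂ := by
    rw [Matrix.mem_unitaryGroup_iff]
    ext i j
    fin_cases i <;> fin_cases j <;> simp [pauliZ, Matrix.mul_apply, Fin.sum_univ_two]
  have := sum_smul_unitaryChannel_mem ![1 - t, t]
    (fun i => by fin_cases i <;> simp [h0, h1]) (by simp) ![1, ⟨pauliZ, hZ⟩]
  simpa [Fin.sum_univ_two, phaseFlip_eq, conjBy_one, unitaryChannel_eq] using this

/-! ### Indivisibility of channels whose Kraus space is the complement of an invertible matrix -/

/-- If all Kraus operators are multiples of one matrix, they merge into a single rescaled operator,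
which trace preservation makes unitary. -/
theorem mem_unitaryChannels_or_exists_indep {ι : Type*} [Fintype ι] {K : ι → Mat2}
    (h : ∀ ρ, (krausMap K ρ).trace = ρ.trace) :
    krausMap K ∈ unitaryChannels ∨
      ∃ i j, ∀ x y : ℂ, x • K i + y • K j = 0 → x = 0 ∧ y = 0 := by
  have h1 := krausMap_sum_eq_one h
  obtain ⟨i, hi⟩ : ∃ i, K i ≠ 0 := by
    by_contra! h0
    simp [h0] at h1
  by_cases hc : ∀ j, ∃ c : ℂ, K j = c • K i
  · left
    choose c hc using hc
    have hk : krausMap K = conjBy ((Real.sqrt (∑ j, ‖c j‖ ^ 2) : ℂ) • K i) := by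
      have hs : (Real.sqrt (∑ j, ‖c j‖ ^ 2) : ℂ) * star (Real.sqrt (∑ j, ‖c j‖ ^ 2) : ℂ) =
          ∑ j, c j * star (c j) := by
        rw [Complex.star_def, Complex.conj_ofReal, ← Complex.ofReal_mul,
          Real.mul_self_sqrt (Finset.sum_nonneg fun _ _ => by positivity)]
        simp [Complex.mul_conj, Complex.normSq_eq_norm_sq]
      rw [conjBy_smul, hs, Finset.sum_smul, krausMap]
      refine Finset.sum_congr rfl fun j _ => ?_
      rw [hc j, conjBy_smul]
    have hk' : conjBy ((Real.sqrt (∑ j, ‖c j‖ ^ 2) : ℂ) • K i) =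
        krausMap fun _ : Unit => (Real.sqrt (∑ j, ‖c j‖ ^ 2) : ℂ) • K i := by
      simp [krausMap]
    have hu := krausMap_sum_eq_one (K := fun _ : Unit =>
      (Real.sqrt (∑ j, ‖c j‖ ^ 2) : ℂ) • K i) (by rw [← hk', ← hk]; exact h)
    rw [Fintype.sum_unique] at hu
    exact ⟨⟨_, Matrix.mem_unitaryGroup_iff'.2 hu⟩, by rw [hk]; rfl⟩
  · right
    push Not at hc
    obtain ⟨j, hj⟩ := hc
    refine ⟨i, j, fun x y hxy => ?_⟩
    have hy : y = 0 := by
      by_contra hy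
      refine hj (-x / y) ?_
      rw [div_eq_inv_mul, mul_smul, neg_smul, ← eq_neg_of_add_eq_zero_right hxy, inv_smul_smul₀ hy]
    subst hy
    simpa [hi] using hxy

theorem exists_eq_vecMulVec {N : Mat2} (h : N.det = 0) (h0 : N ≠ 0) :
    ∃ u v : Fin 2 → ℂ, u ≠ 0 ∧ v ≠ 0 ∧ N = Matrix.vecMulVec u v := by
  rw [Matrix.det_fin_two] at h
  by_cases h1 : N 0 = 0
  · refine ⟨![0, 1], N 1, fun h => by simpa using congrFun h 1, fun h2 => h0 ?_, ?_⟩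
    · ext i j; fin_cases i <;> simp [h1, h2]
    · ext i j; fin_cases i <;> simp [h1, Matrix.vecMulVec_apply]
  · obtain ⟨a, ha⟩ := exists_smul_of_dotProduct_eq_zero (u := N 1) (r := N 0)
      (d := ![N 0 1, -N 0 0])
      (fun h => h1 (by
        ext i; fin_cases i
        · simpa using congrFun h 1
        · simpa using congrFun h 0)) h1
      (by simp [dotProduct, Fin.sum_univ_two]; ring)
      (by simp [dotProduct, Fin.sum_univ_two]; linear_combination -h)
    refine ⟨![1, a], N 0, fun h => by simpa using congrFun h 0, h1, ?_⟩
    ext i j; fin_cases i <;> simp [ha, Matrix.vecMulVec_apply]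

/-- For invertible `A`, the determinant of `x • A + B` is a genuine quadratic polynomial in `x` and
has a complex root. -/
theorem exists_det_smul_add_smul_eq_zero (A B : Mat2) :
    ∃ x y : ℂ, (x ≠ 0 ∨ y ≠ 0) ∧ (x • A + y • B).det = 0 := by
  by_cases hA : A.det = 0
  · exact ⟨1, 0, by simp, by simpa using hA⟩
  · obtain ⟨s, hs⟩ := IsAlgClosed.exists_eq_mul_self (discrim A.det
      (A 0 0 * B 1 1 + B 0 0 * A 1 1 - A 0 1 * B 1 0 - B 0 1 * A 1 0) B.det)
    obtain ⟨x, hx⟩ := exists_quadratic_eq_zero hA ⟨s, hs⟩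
    refine ⟨x, 1, by simp, ?_⟩
    rw [← hx]
    simp only [Matrix.det_fin_two, Matrix.add_apply, Matrix.smul_apply, smul_eq_mul]
    ring

theorem trace_mul_vecMulVec_fin_two (C : Mat2) (x v : Fin 2 → ℂ) :
    (C * Matrix.vecMulVec x v).trace = v ⬝ᵥ (C *ᵥ x) := by
  rw [Matrix.mul_vecMulVec, Matrix.trace_vecMulVec, dotProduct_comm]

/-- If neither factor is unitary, each has two independent Kraus operators, and suitable
combinations of them have rank one. From these one builds a nonzero singular matrix orthogonal to
all products `K i * L j`. By `h1` it would be a multiple of the invertible `W`, which is impossible.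
-/
theorem unitary_or_unitary_of_krausForm {A B : SuperOp} (hA : A ∈ qubitChannels)
    (hB : B ∈ qubitChannels) {W : Mat2} (hW : W.det ≠ 0) (h0 : krausForm (A * B) W = 0)
    (h1 : ∀ M, krausForm (A * B) M = 0 → ∃ c : ℂ, M = c • W) :
    A ∈ unitaryChannels ∨ B ∈ unitaryChannels := by
  obtain ⟨K, rfl⟩ := hA.1.exists_kraus
  obtain ⟨L, rfl⟩ := hB.1.exists_kraus
  rw [krausMap_mul, krausForm_krausMap_eq_zero] at h0
  simp only [krausMap_mul, krausForm_krausMap_eq_zero, Prod.forall] at h0 h1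
  rcases mem_unitaryChannels_or_exists_indep hA.2 with h | ⟨i₁, i₂, hK⟩
  · exact Or.inl h
  rcases mem_unitaryChannels_or_exists_indep hB.2 with h | ⟨j₁, j₂, hL⟩
  · exact Or.inr h
  exfalso
  have hWu : IsUnit W := (Matrix.isUnit_iff_isUnit_det W).2 (isUnit_iff_ne_zero.2 hW)
  obtain ⟨x, y, hxy, hdet⟩ := exists_det_smul_add_smul_eq_zero (L j₁) (L j₂)
  obtain ⟨u, v, hu, hv, huv⟩ := exists_eq_vecMulVec hdet fun h => by
    have := hL x y h; tauto
  have hvu : ∀ i, v ⬝ᵥ ((W * K i) *ᵥ u) = 0 := by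
    intro i
    rw [← trace_mul_vecMulVec_fin_two, ← huv, Matrix.mul_add, Matrix.mul_smul, Matrix.mul_smul,
      Matrix.trace_add, Matrix.trace_smul, Matrix.trace_smul, Matrix.mul_assoc, Matrix.mul_assoc,
      h0, h0]
    simp
  -- All vectors `W K i u` lie on the line annihilated by `v`, so two of them are dependent.
  obtain ⟨α, β, hαβ, hker⟩ : ∃ α β : ℂ, (α ≠ 0 ∨ β ≠ 0) ∧
      (α • (W * K i₁) + β • (W * K i₂)) *ᵥ u = 0 := by
    by_cases h : (W * K i₁) *ᵥ u = 0
    · exact ⟨1, 0, by simp, by simpa using h⟩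
    · obtain ⟨a, ha⟩ := exists_smul_of_dotProduct_eq_zero (u := (W * K i₂) *ᵥ u) hv h
        (by rw [dotProduct_comm]; exact hvu _) (by rw [dotProduct_comm]; exact hvu _)
      refine ⟨-a, 1, by simp, ?_⟩
      rw [Matrix.add_mulVec, Matrix.smul_mulVec, Matrix.smul_mulVec, ha]
      simp
  set N := α • (W * K i₁) + β • (W * K i₂) with hN
  obtain ⟨z, w, hz, hw, hzw⟩ := exists_eq_vecMulVec
    (Matrix.exists_mulVec_eq_zero_iff.1 ⟨u, hu, hker⟩) fun h => by
      have h' : W * (α • K i₁ + β • K i₂) = 0 := by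
        rw [Matrix.mul_add, Matrix.mul_smul, Matrix.mul_smul, ← hN, h]
      have := hK α β (hWu.mul_right_eq_zero.1 h')
      tauto
  have hwu : u ⬝ᵥ w = 0 := by
    obtain ⟨k, hk⟩ := Function.ne_iff.1 hz
    have := congrFun hker k
    rw [hzw] at this
    simp only [Matrix.mulVec, dotProduct, Matrix.vecMulVec_apply, Fin.sum_univ_two,
      Pi.zero_apply] at this
    refine mul_left_cancel₀ hk ?_
    rw [dotProduct, Fin.sum_univ_two]
    linear_combination this
  have hLz : ∀ j, ∃ a : ℂ, L j *ᵥ z = a • u := fun j => by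
    refine exists_smul_of_dotProduct_eq_zero hw hu hwu ?_
    rw [dotProduct_comm, ← trace_mul_vecMulVec_fin_two, ← hzw, Matrix.trace_mul_comm, hN,
      Matrix.add_mul, Matrix.smul_mul, Matrix.smul_mul, Matrix.trace_add, Matrix.trace_smul,
      Matrix.trace_smul, Matrix.mul_assoc, Matrix.mul_assoc, h0, h0]
    simp
  -- The contradictory matrix: every `L j` sends `z` into the line of `u`, and `v` annihilates the
  -- image of `u` under every `W K i`.
  obtain ⟨c, hc⟩ := h1 (Matrix.vecMulVec z v * W) fun i i' j j' => by
    obtain ⟨a, ha⟩ := hLz (j, j')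
    rw [Matrix.mul_assoc, Matrix.trace_mul_comm, trace_mul_vecMulVec_fin_two, ← Matrix.mul_assoc,
      ← Matrix.mulVec_mulVec, ha, Matrix.mulVec_smul, dotProduct_smul, hvu, smul_zero]
  have hd := congrArg Matrix.det hc
  rw [Matrix.det_mul, Matrix.det_smul] at hd
  have hd0 : (Matrix.vecMulVec z v).det = 0 := by
    rw [Matrix.det_fin_two]; simp only [Matrix.vecMulVec_apply]; ring
  rw [hd0, zero_mul] at hd
  have hc0 : c = 0 := by simpa [hW] using hd.symm
  rw [hc0, zero_smul] at hc
  have hzv := hWu.mul_left_eq_zero.1 hc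
  obtain ⟨k, hk⟩ := Function.ne_iff.1 hz
  obtain ⟨l, hl⟩ := Function.ne_iff.1 hv
  have := congrFun (congrFun hzv k) l
  rw [Matrix.vecMulVec_apply] at this
  exact (mul_ne_zero hk hl) this

/-- A channel is indivisible up to unitaries. -/
def IsIndivisible (Φ : SuperOp) : Prop :=
  ∀ A ∈ qubitChannels, ∀ B ∈ qubitChannels, Φ = A * B → A ∈ unitaryChannels ∨ B ∈ unitaryChannels

/-- Indivisibility is unchanged by a unitary factor: if the head is unitary the tail inherits it,
and otherwise the tail product is unitary and the head is the desired letter. -/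
theorem IsIndivisible.exists_mem_list {l : List SuperOp} (hl : ∀ Ψ ∈ l, Ψ ∈ qubitChannels)
    (hne : l ≠ []) (h : IsIndivisible l.prod) : ∃ Ψ ∈ l, UnitarilyEquivalent Ψ l.prod := by
  induction l with
  | nil => exact absurd rfl hne
  | cons A l ih =>
    by_cases hl0 : l = []
    · subst hl0; exact ⟨A, by simp, by simpa using UnitarilyEquivalent.refl A⟩
    have hA := hl A (by simp)
    have hB := list_prod_mem_qubitChannels fun Ψ hΨ => hl Ψ (List.mem_cons_of_mem A hΨ)
    rw [List.prod_cons] at h ⊢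
    rcases h A hA _ hB rfl with ⟨U, rfl⟩ | ⟨U, hU⟩
    · obtain ⟨Ψ, hΨ, X, Y, hXY⟩ := ih (fun Ψ hΨ => hl Ψ (List.mem_cons_of_mem _ hΨ)) hl0 (by
        intro C hC D hD hCD
        rcases h (unitaryChannel U * C) (mul_mem_qubitChannels hA hC) D hD
          (by rw [hCD, mul_assoc]) with ⟨V, hV⟩ | h'
        · refine Or.inl ⟨U⁻¹ * V, ?_⟩
          rw [← unitaryChannel_mul, hV, ← mul_assoc, unitaryChannel_inv_mul, one_mul]
        · exact Or.inr h')
      refine ⟨Ψ, List.mem_cons_of_mem _ hΨ, X * U⁻¹, Y, ?_⟩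
      rw [hXY, ← unitaryChannel_mul]
      simp only [mul_assoc]
      rw [← mul_assoc (unitaryChannel U⁻¹), unitaryChannel_inv_mul, one_mul]
    · refine ⟨A, by simp, 1, U⁻¹, ?_⟩
      rw [← hU, unitaryChannel_one, one_mul, mul_assoc, unitaryChannel_mul_inv, mul_one]

/-! ### Unital channels are mixtures of four orthogonal unitaries -/

/-- The quaternion units `1, iσ_x, iσ_y, iσ_z`. -/
noncomputable def quatUnit : Fin 4 → Mat2 :=
  ![1, !![0, Complex.I; Complex.I, 0], !![0, 1; -1, 0], !![Complex.I, 0; 0, -Complex.I]]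

/-- Matrices of the form of a quaternion. -/
def IsQuat (M : Mat2) : Prop := M 1 1 = star (M 0 0) ∧ M 1 0 = -star (M 0 1)

theorem IsQuat.mul {M N : Mat2} (hM : IsQuat M) (hN : IsQuat N) : IsQuat (M * N) := by
  simp only [IsQuat, Matrix.mul_apply, Fin.sum_univ_two, hM.1, hM.2, hN.1, hN.2]
  constructor
  · simp; ring
  · simp

theorem IsQuat.conjTranspose {M : Mat2} (hM : IsQuat M) : IsQuat Mᴴ := by
  simp [IsQuat, hM.1, hM.2]

theorem IsQuat.conjTranspose_mul_self {M : Mat2} (hM : IsQuat M) (h : (Mᴴ * M).trace = 2) :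
    Mᴴ * M = 1 := by
  have h2 := (hM.conjTranspose.mul hM).1
  have h3 := (hM.conjTranspose.mul hM).2
  have h00 : star ((Mᴴ * M) 0 0) = (Mᴴ * M) 0 0 := by
    simp [Matrix.mul_apply, Fin.sum_univ_two, mul_comm]
  have h01 : (Mᴴ * M) 0 1 = 0 := by
    simp [Matrix.mul_apply, Fin.sum_univ_two, hM.1, hM.2]
    ring
  rw [Matrix.trace_fin_two, h2, h00, ← two_mul] at h
  have h1 : (Mᴴ * M) 0 0 = 1 := by simpa using h
  ext i j
  fin_cases i <;> fin_cases j
  · exact h1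
  · exact h01
  · simpa [h01] using h3
  · simpa [h1] using h2

/-- Preservation of hermiticity alone would give a complex hermitian matrix. Trace preservation and
unitality together remove its imaginary part and fix its trace to be 1: one real and four complex
parameters remain, matching the nine of a real symmetric matrix of trace 1. -/
theorem exists_real_quat_matrix {Φ : SuperOp} (hΦ : Φ ∈ unitalQubitChannels) :
    ∃ R : Matrix (Fin 4) (Fin 4) ℝ, R.IsHermitian ∧ ∀ i j k l, Φ (Matrix.single i j 1) k l =
      ∑ a, ∑ b, (R a b : ℂ) * (quatUnit a k i * star (quatUnit b l j)) := by
  obtain ⟨K, hK⟩ := hΦ.1.1.exists_kraus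
  have herm : ∀ i j k l, Φ (Matrix.single j i 1) l k = star (Φ (Matrix.single i j 1) k l) := by
    intro i j k l
    simp only [hK, krausMap, LinearMap.sum_apply, Matrix.sum_apply, conjBy_single_apply, star_sum]
    simp [mul_comm]
  have htp : ∀ i j, Φ (Matrix.single i j 1) 0 0 + Φ (Matrix.single i j 1) 1 1 =
      if i = j then 1 else 0 := by
    intro i j
    have := hΦ.1.2 (Matrix.single i j 1)
    rw [Matrix.trace_fin_two] at this
    rw [this]
    by_cases h : i = j
    · subst h; simp
    · simp [h, Matrix.trace_single_eq_of_ne]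
  have hun : ∀ k l, Φ (Matrix.single 0 0 1) k l + Φ (Matrix.single 1 1 1) k l =
      if k = l then 1 else 0 := by
    intro k l
    have h1 : (1 : Mat2) = Matrix.single 0 0 1 + Matrix.single 1 1 1 := by
      ext i j; fin_cases i <;> fin_cases j <;> simp
    have := hΦ.2
    rw [map_smul] at this
    have := smul_right_injective Mat2 (by norm_num : (1 / 2 : ℂ) ≠ 0) this
    rw [← Matrix.one_apply, ← this]
    rw [h1, map_add, Matrix.add_apply]
  obtain ⟨a, ha⟩ : ∃ a : ℝ, Φ (Matrix.single 0 0 1) 0 0 = a :=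
    ⟨_, (Complex.conj_eq_iff_re.1 (herm 0 0 0 0).symm).symm⟩
  set b := Φ (Matrix.single 0 0 1) 0 1 with hb
  set c := Φ (Matrix.single 0 1 1) 0 0 with hc
  set d := Φ (Matrix.single 0 1 1) 0 1 with hd
  set e := Φ (Matrix.single 0 1 1) 1 0 with he
  have f0010 : Φ (Matrix.single 0 0 1) 1 0 = star b := herm 0 0 0 1
  have f0011 : Φ (Matrix.single 0 0 1) 1 1 = 1 - a := by
    have := htp 0 0; rw [ha] at this; simp at this; linear_combination this
  have f0111 : Φ (Matrix.single 0 1 1) 1 1 = -c := by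
    have := htp 0 1; rw [← hc] at this; simp at this; linear_combination this
  have f1000 : Φ (Matrix.single 1 0 1) 0 0 = star c := herm 0 1 0 0
  have f1001 : Φ (Matrix.single 1 0 1) 0 1 = star e := herm 0 1 1 0
  have f1010 : Φ (Matrix.single 1 0 1) 1 0 = star d := herm 0 1 0 1
  have f1011 : Φ (Matrix.single 1 0 1) 1 1 = -star c := by
    rw [herm 0 1 1 1, f0111, star_neg]
  have f1100 : Φ (Matrix.single 1 1 1) 0 0 = 1 - a := by
    have := hun 0 0; rw [ha] at this; simp at this; linear_combination this
  have f1101 : Φ (Matrix.single 1 1 1) 0 1 = -b := by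
    have := hun 0 1; rw [← hb] at this; simp at this; linear_combination this
  have f1110 : Φ (Matrix.single 1 1 1) 1 0 = -star b := by
    rw [herm 1 1 0 1, f1101, star_neg]
  have f1111 : Φ (Matrix.single 1 1 1) 1 1 = a := by
    have := hun 1 1; rw [f0011] at this; simp at this; linear_combination this
  refine ⟨!![(a + d.re) / 2, -(b.im + c.im) / 2, (c.re - b.re) / 2, d.im / 2;
    -(b.im + c.im) / 2, (1 - a + e.re) / 2, e.im / 2, (b.re + c.re) / 2;
    (c.re - b.re) / 2, e.im / 2, (1 - a - e.re) / 2, (c.im - b.im) / 2;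
    d.im / 2, (b.re + c.re) / 2, (c.im - b.im) / 2, (a - d.re) / 2], ?_, ?_⟩
  · ext i j
    fin_cases i <;> fin_cases j <;> rfl
  · intro i j k l
    fin_cases i <;> fin_cases j <;> fin_cases k <;> fin_cases l <;>
      simp only [Fin.zero_eta, Fin.mk_one, ha, ← hb, ← hc, ← hd, ← he, f0010, f0011, f0111, f1000,
        f1001, f1010, f1011, f1100, f1101, f1110, f1111] <;>
      apply Complex.ext <;>
      simp [Fin.sum_univ_four, quatUnit] <;> ring

theorem real_spectral {n : Type*} [Fintype n] [DecidableEq n] {R : Matrix n n ℝ}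
    (hR : R.IsHermitian) : ∃ (O : Matrix n n ℝ) (p : n → ℝ), Oᵀ * O = 1 ∧
      ∀ a b, R a b = ∑ m, O a m * p m * O b m := by
  refine ⟨hR.eigenvectorUnitary, hR.eigenvalues, ?_, fun a b => ?_⟩
  · have := Unitary.coe_star_mul_self hR.eigenvectorUnitary
    rwa [Matrix.star_eq_conjTranspose, Matrix.conjTranspose_eq_transpose_of_trivial] at this
  · conv_lhs => rw [hR.spectral_theorem, Unitary.conjStarAlgAut_apply]
    simp [Matrix.mul_apply, Matrix.diagonal_apply]

theorem krausForm_sum_smul_conjBy {ι : Type*} [Fintype ι] (p : ι → ℂ) (U : ι → Mat2) (M : Mat2) :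
    krausForm (∑ k, p k • conjBy (U k)) M =
      ∑ k, p k * (Complex.normSq (M * U k).trace : ℂ) := by
  simp only [krausForm_sum, krausForm_smul, krausForm_conjBy]

/-- Real orthonormal eigenvectors of the matrix from `exists_real_quat_matrix` are coordinates of
orthogonal unit quaternions; the eigenvalues are the weights. -/
theorem exists_quat_mixture {Φ : SuperOp} (hΦ : Φ ∈ unitalQubitChannels) :
    ∃ (p : Fin 4 → ℝ) (U : Fin 4 → Mat2), (∀ k, 0 ≤ p k) ∧ ∑ k, p k = 1 ∧
      Φ = ∑ k, (p k : ℂ) • conjBy (U k) ∧ (∀ k, IsQuat (U k)) ∧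
      ∀ k l, ((U k)ᴴ * U l).trace = if k = l then 2 else 0 := by
  obtain ⟨R, hR, hRΦ⟩ := exists_real_quat_matrix hΦ
  obtain ⟨O, p, hO, hRO⟩ := real_spectral hR
  let U : Fin 4 → Mat2 := fun m => ∑ a, (O a m : ℂ) • quatUnit a
  have hU : ∀ m k i, U m k i = ∑ a, (O a m : ℂ) * quatUnit a k i := fun m k i => by
    simp [U, Matrix.sum_apply]
  have hΦU : Φ = ∑ k, (p k : ℂ) • conjBy (U k) := by
    refine superOp_ext fun i j => ?_
    ext k l
    have hR' : ∀ a b, (R a b : ℂ) * (quatUnit a k i * star (quatUnit b l j)) =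
        ∑ m, (p m : ℂ) * ((O a m * quatUnit a k i) * star (O b m * quatUnit b l j)) := by
      intro a b
      rw [hRO, Complex.ofReal_sum, Finset.sum_mul]
      refine Finset.sum_congr rfl fun m _ => ?_
      simp
      ring
    simp only [hRΦ, hR', LinearMap.sum_apply, LinearMap.smul_apply, Matrix.sum_apply,
      Matrix.smul_apply, conjBy_single_apply, hU, star_sum, smul_eq_mul, Finset.mul_sum]
    rw [Finset.sum_congr rfl fun a _ => Finset.sum_comm, Finset.sum_comm]
    refine Finset.sum_congr rfl fun m _ => ?_
    rw [Finset.sum_comm]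
    refine Finset.sum_congr rfl fun b _ => ?_
    rw [Finset.sum_mul, Finset.mul_sum]
  have hq : ∀ m, IsQuat (U m) := fun m => by
    simp only [IsQuat, hU]
    constructor <;> simp [Fin.sum_univ_four, quatUnit] <;> ring
  have horth : ∀ k l, ((U k)ᴴ * U l).trace = if k = l then 2 else 0 := fun k l => by
    have h := congrFun (congrFun hO k) l
    rw [Matrix.mul_apply, Fin.sum_univ_four, Matrix.one_apply] at h
    simp only [Matrix.transpose_apply] at h
    have h' : ((O 0 k * O 0 l + O 1 k * O 1 l + O 2 k * O 2 l + O 3 k * O 3 l : ℝ) : ℂ) =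
        if k = l then 1 else 0 := by rw [h]; split_ifs <;> simp
    push_cast at h'
    have h2 : (if k = l then 2 else 0 : ℂ) = 2 * if k = l then 1 else 0 := by
      split_ifs <;> simp
    rw [h2, ← h']
    simp only [Matrix.trace_fin_two, Matrix.mul_apply, Fin.sum_univ_two,
      Matrix.conjTranspose_apply, hU]
    simp [Fin.sum_univ_four, quatUnit]
    linear_combination (-2 * (O 1 k * O 1 l + O 3 k * O 3 l) : ℂ) * Complex.I_mul_I
  have hUU : ∀ k, U k * (U k)ᴴ = 1 := fun k =>
    mul_eq_one_comm.1 ((hq k).conjTranspose_mul_self (by simp [horth]))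
  refine ⟨p, U, fun k => ?_, ?_, hΦU, hq, horth⟩
  · obtain ⟨K, hK⟩ := hΦ.1.1.exists_kraus
    have h1 := krausForm_krausMap K (U k)ᴴ
    rw [← hK, hΦU, krausForm_sum_smul_conjBy] at h1
    simp only [horth] at h1
    -- Evaluating the Kraus form at the adjoint of `U k` isolates `p k` by orthogonality; a Kraus
    -- representation shows that the value is nonnegative.
    have h2 : p k * 4 = ∑ i, Complex.normSq ((U k)ᴴ * K i).trace := by
      have : ∑ x, (p x : ℂ) * (Complex.normSq (if k = x then 2 else 0) : ℂ) = p k * 4 := by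
        rw [Finset.sum_eq_single k]
        · norm_num [Complex.normSq_apply]
        · intro b _ hb; simp [hb.symm]
        · simp
      rw [this] at h1
      exact_mod_cast h1
    have : 0 ≤ ∑ i, Complex.normSq ((U k)ᴴ * K i).trace :=
      Finset.sum_nonneg fun _ _ => Complex.normSq_nonneg _
    linarith
  · have h := hΦ.2
    rw [map_smul] at h
    have h := smul_right_injective Mat2 (by norm_num : (1 / 2 : ℂ) ≠ 0) h
    have h := congrFun (congrFun h 0) 0
    rw [hΦU] at h
    simp only [LinearMap.sum_apply, LinearMap.smul_apply, conjBy_apply, Matrix.mul_one, hUU] at h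
    simp only [← Finset.sum_smul] at h
    simp at h
    exact_mod_cast h

/-! ### The Pauli normal form -/

/-- The Pauli matrices. -/
noncomputable def pauli : Fin 4 → Mat2 :=
  ![1, !![0, 1; 1, 0], !![0, -Complex.I; Complex.I, 0], pauliZ]

theorem pauli_conjTranspose (k : Fin 4) : (pauli k)ᴴ = pauli k := by
  ext i j
  fin_cases k <;> fin_cases i <;> fin_cases j <;> simp [pauli, pauliZ]

theorem trace_pauli_mul_pauli (k l : Fin 4) :
    (pauli k * pauli l).trace = if k = l then 2 else 0 := by
  fin_cases k <;> fin_cases l <;>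
    simp [pauli, pauliZ, Matrix.trace_fin_two] <;> norm_num

theorem pauli_mul_self (k : Fin 4) : pauli k * pauli k = 1 := by
  ext i j
  fin_cases k <;> fin_cases i <;> fin_cases j <;>
    simp [pauli, pauliZ, Matrix.mul_apply, Fin.sum_univ_two]

/-- The Pauli matrices as unitaries. -/
noncomputable def pauliUnitary (k : Fin 4) : Matrix.unitaryGroup (Fin 2) ℂ :=
  ⟨pauli k, by rw [Matrix.mem_unitaryGroup_iff, Matrix.star_eq_conjTranspose, pauli_conjTranspose,
    pauli_mul_self]⟩

theorem coe_pauliUnitary (k : Fin 4) : (pauliUnitary k : Mat2) = pauli k := rfl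

/-- Traceless hermitian matrices are unitarily conjugate to multiples of `σ_z`. -/
theorem exists_conj_pauliZ {H : Mat2} (hH : H.IsHermitian) (h0 : H.trace = 0) :
    ∃ (X : Matrix.unitaryGroup (Fin 2) ℂ) (s : ℝ), H = (s : ℂ) • ((X : Mat2) * pauliZ * (X : Mat2)ᴴ) := by
  refine ⟨hH.eigenvectorUnitary, hH.eigenvalues 0, ?_⟩
  have h1 : hH.eigenvalues 1 = -hH.eigenvalues 0 := by
    have := hH.trace_eq_sum_eigenvalues
    rw [h0, Fin.sum_univ_two] at this
    have h' := congrArg Complex.re this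
    simp at h'
    linarith
  have hd : Matrix.diagonal (RCLike.ofReal ∘ hH.eigenvalues) =
      (hH.eigenvalues 0 : ℂ) • pauliZ := by
    ext i j
    fin_cases i <;> fin_cases j <;> simp [pauliZ, h1]
  conv_lhs => rw [hH.spectral_theorem, Unitary.conjStarAlgAut_apply, hd]
  rw [Matrix.mul_smul, Matrix.smul_mul]
  rfl

theorem IsQuat.isHermitian_smul {M : Mat2} (hM : IsQuat M) (h : M.trace = 0) :
    (Complex.I • M).IsHermitian := by
  rw [Matrix.trace_fin_two, hM.1] at h
  have h' : (starRingEnd ℂ) (M 0 0) = -M 0 0 := by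
    rw [starRingEnd_apply]; linear_combination h
  ext i j
  fin_cases i <;> fin_cases j <;> simp [hM.1, hM.2, h']

/-- Three orthogonal traceless hermitian matrices are the Pauli matrices in some basis, up to
signs. -/
theorem exists_unitary_pauli {H : Fin 4 → Mat2} (hH : ∀ k, k ≠ 0 → (H k).IsHermitian)
    (h0 : ∀ k, k ≠ 0 → (H k).trace = 0)
    (hHH : ∀ k l, k ≠ 0 → l ≠ 0 → (H k * H l).trace = if k = l then 2 else 0) :
    ∃ (X : Matrix.unitaryGroup (Fin 2) ℂ) (s : Fin 4 → ℂ), ∀ k, k ≠ 0 → s k * star (s k) = 1 ∧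
      H k = s k • ((X : Mat2) * pauli k * (X : Mat2)ᴴ) := by
  obtain ⟨X, s, hs⟩ := exists_conj_pauliZ (hH 3 (by decide)) (h0 3 (by decide))
  have hX1 : (X : Mat2)ᴴ * (X : Mat2) = 1 := Unitary.coe_star_mul_self X
  have hX2 : (X : Mat2) * (X : Mat2)ᴴ = 1 := Unitary.coe_mul_star_self X
  have hX1' : ∀ M : Mat2, (X : Mat2)ᴴ * ((X : Mat2) * M) = M := fun M => by
    rw [← Matrix.mul_assoc, hX1, Matrix.one_mul]
  have hX2' : ∀ M : Mat2, (X : Mat2) * ((X : Mat2)ᴴ * M) = M := fun M => by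
    rw [← Matrix.mul_assoc, hX2, Matrix.one_mul]
  set G : Fin 4 → Mat2 := fun k => (X : Mat2)ᴴ * H k * (X : Mat2) with hG
  have hHG : ∀ k, H k = (X : Mat2) * G k * (X : Mat2)ᴴ := fun k => by
    simp only [hG, Matrix.mul_assoc, hX2', hX2, Matrix.mul_one]
  have hGH : ∀ k, k ≠ 0 → (G k).IsHermitian := fun k hk => by
    have := hH k hk
    rw [Matrix.IsHermitian] at this ⊢
    simp only [hG, Matrix.conjTranspose_mul, this, Matrix.conjTranspose_conjTranspose,
      Matrix.mul_assoc]
  have hG0 : ∀ k, k ≠ 0 → (G k).trace = 0 := fun k hk => by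
    rw [← h0 k hk]
    simp only [hG]
    rw [Matrix.mul_assoc, Matrix.trace_mul_comm, Matrix.mul_assoc, hX2, Matrix.mul_one]
  have hGG : ∀ k l, k ≠ 0 → l ≠ 0 → (G k * G l).trace = if k = l then 2 else 0 := by
    intro k l hk hl
    rw [← hHH k l hk hl]
    simp only [hG, Matrix.mul_assoc, hX2']
    rw [Matrix.trace_mul_comm]
    simp only [Matrix.mul_assoc, hX2, Matrix.mul_one]
  have hG3 : G 3 = (s : ℂ) • pauliZ := by
    simp only [hG, hs, Matrix.mul_smul, Matrix.smul_mul, Matrix.mul_assoc, hX1', hX1,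
      Matrix.mul_one]
  have hs2 : (s : ℂ) * s = 1 := by
    have := hGG 3 3 (by decide) (by decide)
    rw [hG3] at this
    simp [pauliZ, Matrix.trace_fin_two] at this
    linear_combination this / 2
  -- Orthogonality to the identity and to `σ_z` kills the diagonal. What remains is one unimodular
  -- entry each, `w` and `z`; conjugation by `diag(w, 1)` normalises the first to `σ_x`, and then
  -- the second is `±σ_y`.
  have hdiag : ∀ k, k ≠ 0 → k ≠ 3 → G k 0 0 = 0 ∧ G k 1 1 = 0 := by
    intro k hk hk3
    have h1 := hG0 k hk
    have h2 := hGG k 3 hk (by decide)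
    rw [hG3, if_neg hk3] at h2
    rw [Matrix.trace_fin_two] at h1
    simp [pauliZ, Matrix.trace_fin_two, Matrix.mul_apply, Fin.sum_univ_two] at h2
    have h3 : G k 0 0 - G k 1 1 = 0 := by
      linear_combination s * h2 - (G k 0 0 - G k 1 1) * hs2
    constructor
    · linear_combination h1 / 2 + h3 / 2
    · linear_combination h1 / 2 - h3 / 2
  have hoff : ∀ k, k ≠ 0 → G k 1 0 = star (G k 0 1) := fun k hk =>
    ((hGH k hk).apply 1 0).symm
  have d1 := hdiag 1 (by decide) (by decide)
  have d2 := hdiag 2 (by decide) (by decide)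
  have o1 := hoff 1 (by decide)
  have o2 := hoff 2 (by decide)
  have g11 := hGG 1 1 (by decide) (by decide)
  have g22 := hGG 2 2 (by decide) (by decide)
  have g12 := hGG 1 2 (by decide) (by decide)
  rw [Matrix.trace_fin_two, Matrix.mul_apply, Matrix.mul_apply, Fin.sum_univ_two,
    Fin.sum_univ_two] at g11 g22 g12
  rw [d1.1, d1.2, o1] at g11
  rw [d2.1, d2.2, o2] at g22
  rw [d1.1, d1.2, d2.1, d2.2, o1, o2] at g12
  set w := G 1 0 1 with hw
  set z := G 2 0 1 with hz
  have hw1 : w * star w = 1 := by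
    rw [if_pos rfl] at g11; linear_combination g11 / 2
  have hz1 : z * star z = 1 := by
    rw [if_pos rfl] at g22; linear_combination g22 / 2
  have hwz : w * star z + star w * z = 0 := by
    rw [if_neg (by decide)] at g12; linear_combination g12
  have hwn : ‖w‖ = 1 := by
    have : w * star w = ((‖w‖ ^ 2 : ℝ) : ℂ) := by
      rw [← starRingEnd_apply, Complex.mul_conj, Complex.normSq_eq_norm_sq]
    rw [hw1] at this
    have : ‖w‖ ^ 2 = 1 := by exact_mod_cast this.symm
    nlinarith [norm_nonneg w]
  -- `t` is the sign relating the second matrix to `σ_y`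
  obtain ⟨t, ht⟩ : ∃ t, t = Complex.I * (star w * z) := ⟨_, rfl⟩
  have htt : t * t = 1 := by
    rw [ht]
    linear_combination (star w * z * (star w * z)) * Complex.I_mul_I - star w * z * hwz +
      w * star w * hz1 + hw1
  have hts : star t = t := by
    rw [ht]; simp
    have : w * star z = -(star w * z) := by linear_combination hwz
    simp at this
    rw [this]; ring
  let Y := phaseUnitary w hwn
  have hY : (Y : Mat2) = !![w, 0; 0, 1] := rfl
  have hYc : (Y : Mat2)ᴴ = !![star w, 0; 0, 1] := by
    rw [hY]; ext i j; fin_cases i <;> fin_cases j <;> simp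
  refine ⟨X * Y, ![1, 1, t, s], fun k hk => ?_⟩
  have hGk : G k = (![1, 1, t, s] : Fin 4 → ℂ) k • ((Y : Mat2) * pauli k * (Y : Mat2)ᴴ) := by
    fin_cases k
    · exact absurd rfl hk
    · ext i j
      rw [hYc, hY]
      fin_cases i <;> fin_cases j <;>
        simp [pauli, d1, o1, ← hw]
    · have hzt : z = -(t * (w * Complex.I)) := by
        rw [ht]
        linear_combination (-z * hw1) + (w * star w * z) * Complex.I_mul_I
      have hzt' : star z = t * (Complex.I * star w) := by
        have h := congrArg star hzt
        rw [star_neg, star_mul', star_mul', hts] at h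
        rw [h]
        simp only [Complex.star_def, Complex.conj_I]
        ring
      ext i j
      rw [hYc, hY]
      fin_cases i <;> fin_cases j <;>
        simp [pauli, d2, o2, ← hz]
      · exact hzt
      · exact hzt'
    · ext i j
      rw [hYc, hY]
      fin_cases i <;> fin_cases j <;>
        simp [pauli, hG3, pauliZ]
      simp at hw1
      rw [hw1, mul_one]
  refine ⟨?_, ?_⟩
  · fin_cases k <;> simp
    · simp at hts; rw [hts, htt]
    · exact hs2
  · rw [hHG, hGk, Matrix.mul_smul, Matrix.smul_mul]
    simp [Matrix.mul_assoc]

/-- Unital channels are Pauli channels up to unitaries. -/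
theorem exists_pauli_form {Φ : SuperOp} (hΦ : Φ ∈ unitalQubitChannels) :
    ∃ (p : Fin 4 → ℝ) (V W : Matrix.unitaryGroup (Fin 2) ℂ), (∀ k, 0 ≤ p k) ∧ ∑ k, p k = 1 ∧
      Φ = ∑ k, (p k : ℂ) • unitaryChannel (V * pauliUnitary k * W) := by
  obtain ⟨p, U, hp, hsum, hΦU, hq, horth⟩ := exists_quat_mixture hΦ
  have hUU : ∀ k, (U k)ᴴ * U k = 1 := fun k => (hq k).conjTranspose_mul_self (by simp [horth])
  have hUU' : ∀ k, U k * (U k)ᴴ = 1 := fun k => mul_eq_one_comm.1 (hUU k)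
  -- Dividing by `U 0` makes the other three quaternions purely imaginary; the factor `I` turns
  -- these antihermitian matrices into hermitian ones.
  obtain ⟨X, s, hs⟩ := exists_unitary_pauli (H := fun k => Complex.I • ((U 0)ᴴ * U k))
    (fun k hk => ((hq 0).conjTranspose.mul (hq k)).isHermitian_smul (by simp [horth, hk.symm]))
    (fun k hk => by simp [horth, hk.symm])
    (fun k l hk hl => by
      have hk' := ((hq 0).conjTranspose.mul (hq k)).isHermitian_smul (by simp [horth, hk.symm])
      rw [← hk', Matrix.conjTranspose_smul, Matrix.conjTranspose_mul,
        Matrix.conjTranspose_conjTranspose, Matrix.smul_mul, Matrix.mul_smul, smul_smul,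
        Matrix.mul_assoc, ← Matrix.mul_assoc (U 0), hUU', Matrix.one_mul, Matrix.trace_smul,
        horth]
      simp)
  let U0 : Matrix.unitaryGroup (Fin 2) ℂ := ⟨U 0, Matrix.mem_unitaryGroup_iff.2 (hUU' 0)⟩
  have hX2 : (X : Mat2) * (X : Mat2)ᴴ = 1 := Unitary.coe_mul_star_self X
  refine ⟨p, U0 * X, X⁻¹, hp, hsum, ?_⟩
  rw [hΦU]
  refine Finset.sum_congr rfl fun k _ => ?_
  congr 1
  have hc : ((U0 * X * pauliUnitary k * X⁻¹ : Matrix.unitaryGroup (Fin 2) ℂ) : Mat2) =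
      U 0 * ((X : Mat2) * pauli k * (X : Mat2)ᴴ) := by
    change U 0 * (X : Mat2) * pauli k * (X : Mat2)ᴴ = _
    simp only [Matrix.mul_assoc]
  rw [unitaryChannel_eq, hc]
  by_cases hk : k = 0
  · subst hk
    simp [pauli, hX2]
  · obtain ⟨h1, h2⟩ := hs k hk
    have hUk : U k = (-Complex.I * s k) • (U 0 * ((X : Mat2) * pauli k * (X : Mat2)ᴴ)) := by
      rw [mul_smul, ← Matrix.mul_smul, ← h2, Matrix.mul_smul, smul_smul, ← Matrix.mul_assoc, hUU']
      simp
    rw [hUk, conjBy_smul, star_mul', mul_mul_mul_comm, h1]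
    simp

/-! ### Kraus rank and indivisibility of Pauli mixtures -/

/-- The vectorised `K k` are orthogonal columns of a matrix `Q`, and both the Choi matrix and the
diagonal matrix of weights arise from the other by multiplication with `Q` and its adjoint, up to
scalars. -/
theorem rank_choiMatrix_sum (p : Fin 4 → ℝ) (K : Fin 4 → Mat2)
    (hK : ∀ k l, ((K k)ᴴ * K l).trace = if k = l then 2 else 0) :
    (choiMatrix (∑ k, (p k : ℂ) • conjBy (K k))).rank = Fintype.card {k // p k ≠ 0} := by
  set C := choiMatrix (∑ k, (p k : ℂ) • conjBy (K k)) with hC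
  let Q : Matrix (Fin 2 × Fin 2) (Fin 4) ℂ := Matrix.of fun x k => K k x.1 x.2
  have h1 : C = Q * Matrix.diagonal (fun k => (p k : ℂ) / 2) * Qᴴ := by
    ext x y
    have h := apply_single_eq_choiMatrix (∑ k, (p k : ℂ) • conjBy (K k)) x y
    rw [← hC] at h
    simp only [LinearMap.sum_apply, LinearMap.smul_apply, Matrix.sum_apply, Matrix.smul_apply,
      conjBy_single_apply] at h
    rw [Matrix.mul_apply, ← mul_right_inj' (two_ne_zero (α := ℂ)), ← h, Finset.mul_sum]
    refine Finset.sum_congr rfl fun k _ => ?_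
    rw [Matrix.mul_diagonal]
    simp [Q]
    ring
  have h2 : Qᴴ * Q = (2 : ℂ) • (1 : Matrix (Fin 4) (Fin 4) ℂ) := by
    ext k l
    have := hK k l
    rw [Matrix.trace_fin_two, Matrix.mul_apply, Matrix.mul_apply, Fin.sum_univ_two,
      Fin.sum_univ_two] at this
    rw [Matrix.mul_apply, Fintype.sum_prod_type]
    simp only [Fin.sum_univ_two, Q, Matrix.conjTranspose_apply, Matrix.of_apply,
      Matrix.smul_apply, Matrix.one_apply] at this ⊢
    rw [smul_eq_mul, mul_ite, mul_one, mul_zero, ← this]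
    ring
  have h3 : Qᴴ * C * Q = Matrix.diagonal (fun k => 2 * (p k : ℂ)) := by
    rw [h1]
    calc _ = Qᴴ * Q * Matrix.diagonal (fun k => (p k : ℂ) / 2) * (Qᴴ * Q) := by
          simp only [Matrix.mul_assoc]
      _ = _ := by
        rw [h2, Matrix.smul_mul, Matrix.one_mul, Matrix.mul_smul, Matrix.mul_one,
          ← Matrix.diagonal_smul, ← Matrix.diagonal_smul]
        congr 1; ext k; simp; ring
  apply le_antisymm
  · rw [h1]
    refine (Matrix.rank_mul_le_left _ _).trans ((Matrix.rank_mul_le_right _ _).trans ?_)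
    rw [Matrix.rank_diagonal]
    exact (Fintype.card_congr (Equiv.subtypeEquivRight fun k => by simp)).le
  · have : (Matrix.diagonal (fun k => 2 * (p k : ℂ))).rank ≤ C.rank := by
      rw [← h3]
      exact (Matrix.rank_mul_le_left _ _).trans (Matrix.rank_mul_le_right _ _)
    rw [Matrix.rank_diagonal] at this
    refine le_trans ?_ this
    exact (Fintype.card_congr (Equiv.subtypeEquivRight fun k => by simp)).le

theorem card_ne_zero_eq_three_iff (p : Fin 4 → ℝ) :
    Fintype.card {k // p k ≠ 0} = 3 ↔ ∃ m, p m = 0 ∧ ∀ k, k ≠ m → p k ≠ 0 := by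
  have h := Fintype.card_subtype_compl fun k => p k = 0
  have hle := Fintype.card_subtype_le fun k => p k = 0
  rw [Fintype.card_fin] at h hle
  have h1 : Fintype.card {k // p k ≠ 0} = 3 ↔ Fintype.card {k // p k = 0} = 1 := by
    change Fintype.card {k // ¬ p k = 0} = 3 ↔ _
    omega
  rw [h1, Fintype.card_eq_one_iff]
  constructor
  · rintro ⟨⟨m, hm⟩, h⟩
    exact ⟨m, hm, fun k hk h0 => hk (congrArg Subtype.val (h ⟨k, h0⟩))⟩
  · rintro ⟨m, hm, h⟩
    exact ⟨⟨m, hm⟩, fun ⟨k, hk⟩ => Subtype.ext (by by_contra hne; exact h k hne hk)⟩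

theorem trace_pauli_frame (V W : Matrix.unitaryGroup (Fin 2) ℂ) (k l : Fin 4) :
    (((V * pauliUnitary k * W : Matrix.unitaryGroup (Fin 2) ℂ) : Mat2)ᴴ *
      ((V * pauliUnitary l * W : Matrix.unitaryGroup (Fin 2) ℂ) : Mat2)).trace =
      if k = l then 2 else 0 := by
  have hV : (V : Mat2)ᴴ * (V : Mat2) = 1 := Unitary.coe_star_mul_self V
  have hW : (W : Mat2) * (W : Mat2)ᴴ = 1 := Unitary.coe_mul_star_self W
  change (((V : Mat2) * pauli k * (W : Mat2))ᴴ * ((V : Mat2) * pauli l * (W : Mat2))).trace = _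
  rw [← trace_pauli_mul_pauli, Matrix.conjTranspose_mul, Matrix.conjTranspose_mul,
    pauli_conjTranspose, Matrix.mul_assoc, Matrix.trace_mul_comm]
  congr 1
  calc _ = pauli k * ((V : Mat2)ᴴ * V) * pauli l * ((W : Mat2) * (W : Mat2)ᴴ) := by
        simp only [Matrix.mul_assoc]
    _ = _ := by rw [hV, hW, Matrix.mul_one, Matrix.mul_one]

theorem eq_sum_trace_pauli (N : Mat2) :
    N = (1 / 2 : ℂ) • ∑ k, (N * pauli k).trace • pauli k := by
  ext i j
  rw [Fin.sum_univ_four]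
  fin_cases i <;> fin_cases j <;>
    simp [pauli, pauliZ, Matrix.trace_fin_two, Matrix.mul_apply, Fin.sum_univ_two] <;>
    ring_nf <;> simp <;> ring

/-- Exactly one weight vanishes, so the matrices orthogonal to the Kraus space are the multiples of
the adjoint of the missing unitary, which is invertible. -/
theorem isIndivisible_of_rank_three {Φ : SuperOp} (hΦ : Φ ∈ rankThreeUnitalChannels) :
    IsIndivisible Φ := by
  obtain ⟨p, V, W, hp, -, hΦp⟩ := exists_pauli_form hΦ.1
  let K : Fin 4 → Mat2 := fun k => ((V * pauliUnitary k * W : Matrix.unitaryGroup (Fin 2) ℂ) : Mat2)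
  have hK : Φ = ∑ k, (p k : ℂ) • conjBy (K k) := hΦp
  have hrank := hΦ.2
  rw [hK, rank_choiMatrix_sum p K (trace_pauli_frame V W), card_ne_zero_eq_three_iff] at hrank
  obtain ⟨m, hm, hpos⟩ := hrank
  have hker : ∀ M, krausForm Φ M = 0 ↔ ∀ k, k ≠ m → (M * K k).trace = 0 := by
    intro M
    have : krausForm Φ M = ((∑ k, p k * Complex.normSq (M * K k).trace : ℝ) : ℂ) := by
      rw [hK, krausForm_sum_smul_conjBy]; push_cast; rfl
    rw [this, Complex.ofReal_eq_zero, Finset.sum_eq_zero_iff_of_nonneg fun k _ =>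
      mul_nonneg (hp k) (Complex.normSq_nonneg _)]
    constructor
    · intro h k hk
      simpa [hpos k hk] using h k (Finset.mem_univ k)
    · intro h k _
      by_cases hk : k = m
      · rw [hk, hm, zero_mul]
      · rw [h k hk, map_zero, mul_zero]
  have hdet : ((K m)ᴴ).det ≠ 0 := by
    have h : (K m)ᴴ * K m = 1 := Unitary.coe_star_mul_self (V * pauliUnitary m * W)
    intro h0
    have := congrArg Matrix.det h
    simp [h0] at this
  have hV : (V : Mat2) * (V : Mat2)ᴴ = 1 := Unitary.coe_mul_star_self V
  have hW : (W : Mat2)ᴴ * (W : Mat2) = 1 := Unitary.coe_star_mul_self W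
  have hKk : ∀ k, K k = (V : Mat2) * pauli k * (W : Mat2) := fun k => rfl
  intro A hA B hB hAB
  refine unitary_or_unitary_of_krausForm hA hB hdet ?_ fun M hM => ?_
  · rw [← hAB, hker]
    intro k hk
    have := trace_pauli_frame V W m k
    rwa [if_neg hk.symm] at this
  · rw [← hAB, hker] at hM
    have hN := eq_sum_trace_pauli ((W : Mat2) * M * (V : Mat2))
    have htr : ∀ k, ((W : Mat2) * M * (V : Mat2) * pauli k).trace = (M * K k).trace := by
      intro k
      rw [hKk, Matrix.mul_assoc, Matrix.mul_assoc, Matrix.trace_mul_comm]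
      simp only [Matrix.mul_assoc]
    rw [Finset.sum_eq_single m (fun k _ hk => by rw [htr, hM k hk, zero_smul]) (by simp)] at hN
    refine ⟨(1 / 2 : ℂ) * ((W : Mat2) * M * (V : Mat2) * pauli m).trace, ?_⟩
    calc M = ((W : Mat2)ᴴ * W) * M * ((V : Mat2) * (V : Mat2)ᴴ) := by
          rw [hV, hW, Matrix.one_mul, Matrix.mul_one]
      _ = (W : Mat2)ᴴ * ((W : Mat2) * M * (V : Mat2)) * (V : Mat2)ᴴ := by
          simp only [Matrix.mul_assoc]
      _ = _ := by
          nth_rw 1 [hN]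
          rw [hKk, Matrix.conjTranspose_mul, Matrix.conjTranspose_mul, pauli_conjTranspose,
            smul_smul, Matrix.mul_smul, Matrix.smul_mul, Matrix.mul_assoc (W : Mat2)ᴴ]

/-! ### Universality -/

theorem mem_generatedBy {F : Set SuperOp} {Φ : SuperOp} (h : Φ ∈ F) : Φ ∈ generatedBy F :=
  ⟨[Φ], by simp, by simpa using h, by simp⟩

theorem mul_mem_generatedBy {F : Set SuperOp} {Φ Ψ : SuperOp} (hΦ : Φ ∈ generatedBy F)
    (hΨ : Ψ ∈ generatedBy F) : Φ * Ψ ∈ generatedBy F := by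
  obtain ⟨l, hl, hlF, rfl⟩ := hΦ
  obtain ⟨l', -, hlF', rfl⟩ := hΨ
  refine ⟨l ++ l', by simp [hl], fun X hX => ?_, by simp⟩
  rcases List.mem_append.1 hX with h | h
  exacts [hlF X h, hlF' X h]

theorem unitaryChannel_mem_generatedBy (ε : ℝ) (U : Matrix.unitaryGroup (Fin 2) ℂ) :
    unitaryChannel U ∈ generatedBy (universalSet ε) :=
  mem_generatedBy (Or.inr ⟨U, rfl⟩)

theorem dephasing_mem_generatedBy {ε : ℝ} (hε : 0 < ε) (r : ℝ) (h0 : -1 ≤ r) (h1 : r ≤ 1) :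
    dephasing r ∈ generatedBy (universalSet ε) := by
  -- All multipliers in `[q, 1]` come from available flips; powers of `q` then reach any positive
  -- multiplier. The bound `1 / 2` keeps `q` positive for large `ε`.
  obtain ⟨q, hq0, hq1, hqε⟩ : ∃ q : ℝ, 0 < q ∧ q < 1 ∧ (1 - q) / 2 ≤ ε :=
    ⟨max (1 / 2) (1 - ε), by positivity, max_lt (by norm_num) (by linarith), by
      have := le_max_right (1 / 2) (1 - ε); linarith⟩
  have base : ∀ r : ℝ, q ≤ r → r ≤ 1 → dephasing r ∈ generatedBy (universalSet ε) := by
    intro r hr hr1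
    rw [← phaseFlip_eq_dephasing]
    exact mem_generatedBy (Or.inl (Or.inl (Or.inr
      ⟨(1 - r) / 2, by linarith, by linarith, by linarith, rfl⟩)))
  have pow : ∀ (n : ℕ) (r : ℝ), q ^ n ≤ r → r ≤ 1 →
      dephasing r ∈ generatedBy (universalSet ε) := by
    intro n
    induction n with
    | zero => intro r hr hr1; exact base r (by rw [pow_zero] at hr; linarith) hr1
    | succ n ih =>
      intro r hr hr1
      rcases le_total q r with h | h
      · exact base r h hr1
      · have h2 : dephasing r = dephasing q * dephasing ((r / q : ℝ) : ℂ) := by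
          rw [dephasing_mul, ← Complex.ofReal_mul, mul_div_cancel₀ _ hq0.ne']
        rw [h2]
        exact mul_mem_generatedBy (base q le_rfl hq1.le)
          (ih _ (by rw [le_div_iff₀ hq0, ← pow_succ]; exact hr) (by rwa [div_le_one hq0]))
  have nonneg : ∀ r : ℝ, 0 ≤ r → r ≤ 1 → dephasing r ∈ generatedBy (universalSet ε) := by
    intro r hr hr1
    rcases hr.eq_or_lt with rfl | hr
    · rw [← phaseFlip_eq_dephasing, sub_zero]
      exact mem_generatedBy (Or.inl (Or.inr rfl))
    · obtain ⟨n, hn⟩ := exists_pow_lt_of_lt_one hr hq1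
      exact pow n r hn.le hr1
  rcases le_total 0 r with h | h
  · exact nonneg r h h1
  · have h2 : dephasing r = dephasing ((-r : ℝ) : ℂ) * dephasing (-1) := by
      rw [dephasing_mul]; simp
    rw [h2, dephasing_phase (-1) (by simp)]
    exact mul_mem_generatedBy (nonneg _ (by linarith) (by linarith))
      (unitaryChannel_mem_generatedBy ε _)

theorem phaseFlip_mem_generatedBy {ε : ℝ} (hε : 0 < ε) (t : ℝ) (h0 : 0 ≤ t) (h1 : t ≤ 1) :
    phaseFlip t ∈ generatedBy (universalSet ε) := by
  have : t = (1 - (1 - 2 * t)) / 2 := by ring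
  rw [this, phaseFlip_eq_dephasing]
  exact dephasing_mem_generatedBy hε _ (by linarith) (by linarith)

/-! ### Pauli mixtures and splitting off a phase flip -/

/-- The index of the Pauli matrix proportional to a product of Pauli matrices. -/
def pauliIdx : Fin 4 → Fin 4 → Fin 4 := ![![0, 1, 2, 3], ![1, 0, 3, 2], ![2, 3, 0, 1], ![3, 2, 1, 0]]

theorem pauliIdx_ne_zero {i j : Fin 4} (h : i ≠ j) : pauliIdx i j ≠ 0 := by
  decide +revert

theorem pauliIdx_pauliIdx (i j : Fin 4) : pauliIdx i (pauliIdx i j) = j := by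
  decide +revert

theorem pauli_mul (i j : Fin 4) :
    pauli i * pauli j = (![![1, 1, 1, 1], ![1, 1, Complex.I, -Complex.I],
      ![1, -Complex.I, 1, Complex.I], ![1, Complex.I, -Complex.I, 1]] : Fin 4 → Fin 4 → ℂ) i j •
        pauli (pauliIdx i j) := by
  ext k l
  fin_cases i <;> fin_cases j <;> fin_cases k <;> fin_cases l <;>
    simp [pauli, pauliZ, pauliIdx]

theorem pauliChannel_mul (i j : Fin 4) :
    unitaryChannel (pauliUnitary i) * unitaryChannel (pauliUnitary j) =
      unitaryChannel (pauliUnitary (pauliIdx i j)) := by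
  simp only [unitaryChannel_eq, conjBy_mul, coe_pauliUnitary]
  rw [pauli_mul, conjBy_smul]
  convert one_smul ℂ _
  fin_cases i <;> fin_cases j <;> simp

/-- The mixture of the Pauli channels with weights `p`. -/
noncomputable def pauliMixture (p : Fin 4 → ℝ) : SuperOp :=
  ∑ k, (p k : ℂ) • unitaryChannel (pauliUnitary k)

/-- Multiplication by `σ_z` swaps the indices 0 and 3, and the indices 1 and 2. -/
theorem phaseFlip_mul_pauliMixture (t : ℝ) (q : Fin 4 → ℝ) :
    phaseFlip t * pauliMixture q = pauliMixture ![(1 - t) * q 0 + t * q 3,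
      (1 - t) * q 1 + t * q 2, (1 - t) * q 2 + t * q 1, (1 - t) * q 3 + t * q 0] := by
  have h3 : conjBy pauliZ = unitaryChannel (pauliUnitary 3) := rfl
  rw [phaseFlip_eq, h3]
  simp only [pauliMixture, Fin.sum_univ_four, add_mul, mul_add, smul_mul_smul_comm, one_mul,
    pauliChannel_mul]
  simp [pauliIdx]
  module

/-- A nontrivial Pauli matrix is conjugate to `±σ_z`, so this is a phase flip in a rotated basis. -/
theorem smul_add_smul_pauliChannel_mem {ε : ℝ} (hε : 0 < ε) {a b : ℝ} (ha : 0 ≤ a) (hb : 0 ≤ b)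
    (hab : a + b = 1) {m : Fin 4} (hm : m ≠ 0) :
    (a : ℂ) • (1 : SuperOp) + (b : ℂ) • unitaryChannel (pauliUnitary m) ∈
      generatedBy (universalSet ε) := by
  obtain ⟨X, s, hs⟩ := exists_conj_pauliZ (H := pauli m) (pauli_conjTranspose m)
    (by
      have := trace_pauli_mul_pauli 0 m
      rw [if_neg hm.symm] at this
      simpa [pauli] using this)
  have hss : (s : ℂ) * star (s : ℂ) = 1 := by
    have hX1 : (X : Mat2)ᴴ * (X : Mat2) = 1 := Unitary.coe_star_mul_self X
    have hX2 : (X : Mat2) * (X : Mat2)ᴴ = 1 := Unitary.coe_mul_star_self X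
    have h := pauli_mul_self m
    have hz : pauliZ * pauliZ = 1 := pauli_mul_self 3
    rw [hs, Matrix.smul_mul, Matrix.mul_smul, smul_smul] at h
    have h' : (X : Mat2) * pauliZ * (X : Mat2)ᴴ * ((X : Mat2) * pauliZ * (X : Mat2)ᴴ) = 1 := by
      calc _ = (X : Mat2) * (pauliZ * ((X : Mat2)ᴴ * X) * pauliZ) * (X : Mat2)ᴴ := by
            simp only [Matrix.mul_assoc]
        _ = 1 := by rw [hX1, Matrix.mul_one, hz, Matrix.mul_one, hX2]
    rw [h'] at h
    simpa using congrFun (congrFun h 0) 0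
  have hch : unitaryChannel (pauliUnitary m) =
      unitaryChannel X * conjBy pauliZ * unitaryChannel X⁻¹ := by
    rw [unitaryChannel_eq, coe_pauliUnitary, hs, conjBy_smul, hss, one_smul, unitaryChannel_eq,
      unitaryChannel_eq, conjBy_mul, conjBy_mul]
    rfl
  have : (a : ℂ) • (1 : SuperOp) + (b : ℂ) • unitaryChannel (pauliUnitary m) =
      unitaryChannel X * phaseFlip b * unitaryChannel X⁻¹ := by
    rw [phaseFlip_eq, mul_add, add_mul, mul_smul_comm, mul_smul_comm, smul_mul_assoc,
      smul_mul_assoc, mul_one, unitaryChannel_mul_inv, ← hch, ← hab, add_sub_cancel_right]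
  rw [this]
  exact mul_mem_generatedBy (mul_mem_generatedBy (unitaryChannel_mem_generatedBy ε X)
    (phaseFlip_mem_generatedBy hε b hb (by linarith))) (unitaryChannel_mem_generatedBy ε _)

theorem pauliMixture_mem_of_eq_zero {ε : ℝ} (hε : 0 < ε) {p : Fin 4 → ℝ} (hp : ∀ k, 0 ≤ p k)
    (hs : ∑ k, p k = 1) {m : Fin 4} (hm : p m = 0) :
    pauliMixture p ∈ generatedBy (universalSet ε) := by
  by_cases h : ∃ m', m' ≠ m ∧ p m' = 0
  · obtain ⟨m', hne, hm'⟩ := h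
    obtain ⟨i, j, hij, h⟩ : ∃ i j : Fin 4, i ≠ j ∧ ∀ k, k ≠ i ∧ k ≠ j → k = m ∨ k = m' := by
      clear hm hm'
      decide +revert
    have h0 : ∀ k, k ≠ i ∧ k ≠ j → p k = 0 := fun k hk => by
      rcases h k hk with rfl | rfl <;> assumption
    have hsum : p i + p j = 1 := by
      rw [← hs, Fintype.sum_eq_add i j hij h0]
    have hmix : pauliMixture p = unitaryChannel (pauliUnitary i) * ((p i : ℂ) • (1 : SuperOp) +
        (p j : ℂ) • unitaryChannel (pauliUnitary (pauliIdx i j))) := by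
      rw [pauliMixture, Fintype.sum_eq_add i j hij fun k hk => by rw [h0 k hk]; simp,
        mul_add, mul_smul_comm, mul_smul_comm, mul_one, pauliChannel_mul, pauliIdx_pauliIdx]
    rw [hmix]
    exact mul_mem_generatedBy (unitaryChannel_mem_generatedBy ε _)
      (smul_add_smul_pauliChannel_mem hε (hp i) (hp j) hsum (pauliIdx_ne_zero hij))
  · push Not at h
    refine mem_generatedBy (Or.inl (Or.inl (Or.inl
      ⟨sum_smul_unitaryChannel_mem p hp hs pauliUnitary, ?_⟩)))
    have := rank_choiMatrix_sum p pauli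
      (fun k l => by rw [pauli_conjTranspose, trace_pauli_mul_pauli])
    rw [(card_ne_zero_eq_three_iff p).2 ⟨m, hm, h⟩] at this
    exact this

theorem pauliMixture_mem {ε : ℝ} (hε : 0 < ε) {p : Fin 4 → ℝ} (hp : ∀ k, 0 ≤ p k)
    (hs : ∑ k, p k = 1) : pauliMixture p ∈ generatedBy (universalSet ε) := by
  by_cases h0 : ∃ m, p m = 0
  · obtain ⟨m, hm⟩ := h0
    exact pauliMixture_mem_of_eq_zero hε hp hs hm
  push Not at h0
  have hpos : ∀ k, 0 < p k := fun k => lt_of_le_of_ne (hp k) (h0 k).symm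
  have p0 := hpos 0
  have p1 := hpos 1
  have p2 := hpos 2
  have p3 := hpos 3
  rw [Fin.sum_univ_four] at hs
  -- The largest `r` for which inverting a flip of parameter `r / (1 + r)` leaves nonnegative
  -- weights; maximality makes one of them zero.
  obtain ⟨r, hr, h03, h30, h12, h21, heq⟩ : ∃ r : ℝ, 0 < r ∧ r * p 3 ≤ p 0 ∧ r * p 0 ≤ p 3 ∧
      r * p 2 ≤ p 1 ∧ r * p 1 ≤ p 2 ∧
      (p 0 = r * p 3 ∨ p 3 = r * p 0 ∨ p 1 = r * p 2 ∨ p 2 = r * p 1) := by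
    refine ⟨min (min (p 0 / p 3) (p 3 / p 0)) (min (p 1 / p 2) (p 2 / p 1)), by positivity,
      ?_, ?_, ?_, ?_, ?_⟩
    · rw [← le_div_iff₀ p3]; simp
    · rw [← le_div_iff₀ p0]; simp
    · rw [← le_div_iff₀ p2]; simp
    · rw [← le_div_iff₀ p1]; simp
    · rw [← div_eq_iff p3.ne', ← div_eq_iff p0.ne', ← div_eq_iff p2.ne', ← div_eq_iff p1.ne']
      rcases min_choice (min (p 0 / p 3) (p 3 / p 0)) (min (p 1 / p 2) (p 2 / p 1)) with h | h <;>
        rw [h]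
      · rcases min_choice (p 0 / p 3) (p 3 / p 0) with h | h <;> rw [h] <;> simp
      · rcases min_choice (p 1 / p 2) (p 2 / p 1) with h | h <;> rw [h] <;> simp
  have hr1 : r ≤ 1 := by
    by_contra! h
    nlinarith
  -- At `r = 1` the flip is the half flip, which is not invertible; but then the weights agree
  -- within each swapped pair and a preimage is explicit.
  rcases hr1.eq_or_lt with rfl | hr1
  · have e1 : p 3 = p 0 := by linarith
    have e2 : p 2 = p 1 := by linarith
    have : pauliMixture p = phaseFlip (1 / 2) * pauliMixture ![2 * p 0, 2 * p 1, 0, 0] := by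
      rw [phaseFlip_mul_pauliMixture]
      congr 1
      ext k
      fin_cases k <;> simp [e1, e2] <;> ring
    rw [this]
    refine mul_mem_generatedBy (phaseFlip_mem_generatedBy hε _ (by norm_num) (by norm_num))
      (pauliMixture_mem_of_eq_zero hε (fun k => ?_) ?_ (m := 3) rfl)
    · fin_cases k <;> simp [p0.le, p1.le]
    · simp [Fin.sum_univ_four]; linarith
  · have hr' : 0 < 1 - r := by linarith
    have hr'' : 0 < 1 + r := by linarith
    have : pauliMixture p = phaseFlip (r / (1 + r)) * pauliMixture ![(p 0 - r * p 3) / (1 - r),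
        (p 1 - r * p 2) / (1 - r), (p 2 - r * p 1) / (1 - r), (p 3 - r * p 0) / (1 - r)] := by
      rw [phaseFlip_mul_pauliMixture]
      congr 1
      ext k
      fin_cases k <;> simp <;> field_simp <;> ring
    rw [this]
    have hz : ∃ m, (![(p 0 - r * p 3) / (1 - r), (p 1 - r * p 2) / (1 - r),
        (p 2 - r * p 1) / (1 - r), (p 3 - r * p 0) / (1 - r)] : Fin 4 → ℝ) m = 0 := by
      rcases heq with h | h | h | h
      · exact ⟨0, by simp [sub_eq_zero.2 h]⟩
      · exact ⟨3, by simp [sub_eq_zero.2 h]⟩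
      · exact ⟨1, by simp [sub_eq_zero.2 h]⟩
      · exact ⟨2, by simp [sub_eq_zero.2 h]⟩
    obtain ⟨m, hm⟩ := hz
    refine mul_mem_generatedBy (phaseFlip_mem_generatedBy hε _ (by positivity)
      (by rw [div_le_one hr'']; linarith)) (pauliMixture_mem_of_eq_zero hε (fun k => ?_) ?_ hm)
    · fin_cases k <;> simp <;> exact div_nonneg (by linarith) hr'.le
    · rw [Fin.sum_univ_four]
      simp
      field_simp
      linear_combination (1 - r) * hs

theorem unital_subset_generatedBy {ε : ℝ} (hε : 0 < ε) :
    unitalQubitChannels ⊆ generatedBy (universalSet ε) := by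
  intro Φ hΦ
  obtain ⟨p, V, W, hp, hs, rfl⟩ := exists_pauli_form hΦ
  have : ∑ k, (p k : ℂ) • unitaryChannel (V * pauliUnitary k * W) =
      unitaryChannel V * pauliMixture p * unitaryChannel W := by
    simp only [pauliMixture, Finset.mul_sum, Finset.sum_mul, ← unitaryChannel_mul, mul_smul_comm,
      smul_mul_assoc]
  rw [this]
  exact mul_mem_generatedBy (mul_mem_generatedBy (unitaryChannel_mem_generatedBy ε V)
    (pauliMixture_mem hε hp hs)) (unitaryChannel_mem_generatedBy ε W)

theorem universalSet_subset (ε : ℝ) : universalSet ε ⊆ unitalQubitChannels := by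
  rintro Φ (((h | ⟨t, h0, h1, -, rfl⟩) | rfl) | ⟨U, rfl⟩)
  · exact h.1
  · exact phaseFlip_mem t h0 h1
  · exact phaseFlip_mem _ (by norm_num) (by norm_num)
  · exact unitaryChannel_mem U

theorem generatedBy_subset {F : Set SuperOp} (hF : F ⊆ unitalQubitChannels) :
    generatedBy F ⊆ unitalQubitChannels := by
  rintro _ ⟨l, -, hl, rfl⟩
  induction l with
  | nil => rw [List.prod_nil, ← unitaryChannel_one]; exact unitaryChannel_mem 1
  | cons A l ih =>
    rw [List.prod_cons]
    exact mul_mem_unitalQubitChannels (hF (hl A (by simp))) (ih fun Ψ hΨ => hl Ψ (by simp [hΨ]))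

/-! ### Universality and minimality combined -/

theorem theorem3p6 (ε : ℝ) (hε : 0 < ε) :
    -- the set is universal, and it generates nothing but unital channels
    IsUniversalFor (universalSet ε) unitalQubitChannels ∧
    generatedBy (universalSet ε) = unitalQubitChannels ∧
    -- minimality
    ∀ F : Set SuperOp, IsUniversalFor F unitalQubitChannels →
      (∀ Φ ∈ rankThreeUnitalChannels, ∃ Ψ ∈ F, UnitarilyEquivalent Ψ Φ) ∧
      (∃ Ψ ∈ F, UnitarilyEquivalent Ψ (phaseFlip (1 / 2))) ∧
      (∃ ε' : ℝ, 0 < ε' ∧ ε' ≤ ε ∧ ε' < 1 / 2 ∧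
        ∃ Ψ ∈ F, UnitarilyEquivalent Ψ (phaseFlip ε')) := by
  refine ⟨⟨fun Φ hΦ => (universalSet_subset ε hΦ).1, unital_subset_generatedBy hε⟩,
    (generatedBy_subset (universalSet_subset ε)).antisymm (unital_subset_generatedBy hε),
    fun F hF => ⟨fun Φ hΦ => ?_, ?_, ?_⟩⟩
  · obtain ⟨l, hne, hl, rfl⟩ := hF.2 hΦ.1
    obtain ⟨Ψ, hΨ, h⟩ := (isIndivisible_of_rank_three hΦ).exists_mem_list
      (fun Ψ hΨ => hF.1 (hl Ψ hΨ)) hne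
    exact ⟨Ψ, hl Ψ hΨ, h⟩
  · obtain ⟨l, hne, hl, h⟩ := hF.2 (phaseFlip_mem (1 / 2) (by norm_num) (by norm_num))
    obtain ⟨Ψ, hΨ, h⟩ := exists_mem_list_of_prod_equiv_half (fun Ψ hΨ => hF.1 (hl Ψ hΨ))
      (by rw [← h, sub_zero]; exact UnitarilyEquivalent.refl _) hne
    rw [sub_zero] at h
    exact ⟨Ψ, hl Ψ hΨ, h⟩
  -- Capping at `1 / 4` keeps the multiplier `1 - 2 * t` positive, so that the letter found has
  -- parameter at most `t`, hence below `1 / 2`.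
  · set t := min ε (1 / 4) with ht
    have ht0 : 0 < t := lt_min hε (by norm_num)
    have ht1 : t ≤ 1 / 4 := min_le_right _ _
    have htε : t ≤ ε := min_le_left _ _
    obtain ⟨l, hne, hl, h⟩ := hF.2 (phaseFlip_mem t ht0.le (by linarith))
    obtain ⟨Ψ, hΨ, s, hs, hs1, h⟩ := exists_mem_list_of_prod_equiv_phaseFlip (r := 1 - 2 * t)
      (fun Ψ hΨ => hF.1 (hl Ψ hΨ)) (by linarith) (by linarith)
      (by
        rw [← h, show (1 - (1 - 2 * t)) / 2 = t by ring]
        exact UnitarilyEquivalent.refl _) hne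
    exact ⟨(1 - s) / 2, by linarith, by linarith, by linarith, Ψ, hl Ψ hΨ, h⟩
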